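/- Fix a dimension $d\ge 1$ and a real number $a>0$. There are constants $c,c_1>0$, depending only on $d$ (and on the fixed number $a$), such that the following holds for every odd integer $L>1$, all integers $m\ge k\ge 1$ and every $\bar\mu_0\ge 0$. Let $\eta=L^{-k}$ and let $\Omega=\eta\{0,1,\dots,n-1\}^d\subset\eta\mathbb Z^d$, where $n=L^m+1$ or $n=L^m$. Let $\Delta^\eta_\Omega$ be the lattice Laplacian with Neumann boundary conditions, acting on functions $f:\Omega\to\mathbb C$ by $$(\Delta^\eta_\Omega f)(x)=\sum_{\mu=0}^{d-1}\eta^{-2}\big(f(x+\eta e_\mu)-2f(x)+f(x-\eta e_\mu)\big),$$ where $f(x\pm\eta e_\mu):=f(x)$ whenever $x\pm\eta e_\mu\notin\Omega$. Let $\Omega_k=\Omega\cap\mathbb Z^d$ and, for $y\in\Omega_k$, let $B_k(y)=\{x\in\Omega: y_\mu\le x_\mu<y_\mu+1,\ \mu=0,\dots,d-1\}$ and $(Q_kf)(y)=L^{-kd}\sum_{x\in B_k(y)}f(x)$. Let $Q_k^*$ be the adjoint of $Q_k$ with respect to the scalar products $\eta^d\sum_{x\in\Omega}\overline{f(x)}g(x)$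 on $\Omega$ and $\sum_{y\in\Omega_k}\overline{f(y)}g(y)$ on $\Omega_k$; that is, $(Q_k^*h)(x)=h(y)$ if $x\in B_k(y)$. Put $\bar\mu_k=L^{2k}\bar\mu_0$ and $a_k=a\,\frac{1-L^{-2}}{1-L^{-2k}}$. Then $-\Delta^\eta_\Omega+\bar\mu_k+a_kQ_k^*Q_k$ is invertible, and its inverse $G_k(\Omega)$ satisfies, for every $f:\Omega\to\mathbb C$ and every $x\in\Omega$, $$|(G_k(\Omega)f)(x)|\le c\,L^{2d}\,e^{-c_1\,\mathrm d(x,\mathrm{supp} f)}\,\|f\|_\infty ,$$ where $\mathrm d(x,\mathrm{supp} f)=\inf_{y\in\mathrm{supp} f}|x-y|$ is the Euclidean distance and $\|f\|_\infty=\sup_{x\in\Omega}|f(x)|$. In particular $c,c_1$ do not depend on $L$, the lattice spacing, the size of $\Omega$ or $\bar\mu_0$. -/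

import Mathlib

open scoped BigOperators ComplexConjugate

noncomputable section

namespace LatticeGreen

/-- The finite cube `η {0, …, n-1}^d`: its points are labelled by their integer coordinates. -/
abbrev Cube (d n : ℕ) : Type := Fin d → Fin n

/-- The point `η κ` of `ℝ^d` (with the Euclidean norm) that belongs to the label `κ`. -/
def pt {d n : ℕ} (η : ℝ) (x : Cube d n) : EuclideanSpace ℝ (Fin d) :=
  WithLp.toLp 2 (fun i => η * ((x i : ℕ) : ℝ))

/-- Right neighbour in `{0, …, n-1}`, with the convention that the right neighbour of `n-1` is
`n-1` (this is the Neumann condition `v_n := v_{n-1}`). -/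
def next {n : ℕ} (i : Fin n) : Fin n :=
  ⟨min ((i : ℕ) + 1) (n - 1), by have := i.isLt; omega⟩

/-- Left neighbour in `{0, …, n-1}`, with the convention that the left neighbour of `0` is `0`
(this is the Neumann condition `v_{-1} := v_0`; note the truncated subtraction). -/
def prev {n : ℕ} (i : Fin n) : Fin n :=
  ⟨(i : ℕ) - 1, by have := i.isLt; omega⟩

/-- The lattice Laplacian on the cube with spacing `η` and Neumann boundary conditions, the sum
over the directions `i` of the second difference quotients
`(v_{κ+e_i} - 2 v_κ + v_{κ-e_i}) / η^2`. -/
def neumannLaplacian (d n : ℕ) (η : ℝ) : (Cube d n → ℂ) →ₗ[ℂ] (Cube d n → ℂ) where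
  toFun f x := ∑ i : Fin d,
    (f (Function.update x i (next (x i))) - 2 * f x + f (Function.update x i (prev (x i))))
      / (η : ℂ) ^ 2
  map_add' f g := by
    funext x
    simp only [Pi.add_apply, ← Finset.sum_add_distrib]
    exact Finset.sum_congr rfl fun i _ => by ring
  map_smul' r f := by
    funext x
    simp only [Pi.smul_apply, smul_eq_mul, RingHom.id_apply, Finset.mul_sum]
    exact Finset.sum_congr rfl fun i _ => by ring

/-- The coarse lattice: the points of the cube whose integer coordinates are all multiples of `N`
(for `N = L^k` this is `(L^k Ω) ∩ Ω`). -/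
abbrev CoarseCube (d n N : ℕ) : Type := {y : Cube d n // ∀ i, N ∣ (y i : ℕ)}

/-- The box of side `N` with label `y`, intersected with the cube. -/
def box {d n N : ℕ} (y : CoarseCube d n N) : Finset (Cube d n) :=
  Finset.univ.filter fun x => ∀ i, (y.1 i : ℕ) ≤ (x i : ℕ) ∧ (x i : ℕ) < (y.1 i : ℕ) + N

/-- The label `y_x` of the box to which `x` belongs: `(y_x)_i = N [x_i / N]`. -/
def boxLabel {d n : ℕ} (N : ℕ) (x : Cube d n) : CoarseCube d n N :=
  ⟨fun i => ⟨N * ((x i : ℕ) / N), lt_of_le_of_lt (Nat.mul_div_le _ _) (x i).isLt⟩,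
    fun i => ⟨(x i : ℕ) / N, rfl⟩⟩

/-- The averaging operator `(Q f)(y) = N^{-d} ∑_{x ∈ B(y)} f x`. -/
def avg (d n N : ℕ) : (Cube d n → ℂ) →ₗ[ℂ] (CoarseCube d n N → ℂ) where
  toFun f y := ((N : ℂ) ^ d)⁻¹ * ∑ x ∈ box y, f x
  map_add' f g := by
    funext y
    simp only [Pi.add_apply, Finset.sum_add_distrib, mul_add]
  map_smul' r f := by
    funext y
    simp only [Pi.smul_apply, smul_eq_mul, RingHom.id_apply, ← Finset.mul_sum]
    ring

/-- The adjoint of the averaging operator, `(Q^* h)(x) = h(y_x)`. -/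
def avgAdj (d n N : ℕ) : (CoarseCube d n N → ℂ) →ₗ[ℂ] (Cube d n → ℂ) where
  toFun h x := h (boxLabel N x)
  map_add' _ _ := rfl
  map_smul' _ _ := rfl

theorem mem_box_iff {d n N : ℕ} (hN : 0 < N) (y : CoarseCube d n N) (x : Cube d n) :
    x ∈ box y ↔ boxLabel N x = y := by
  simp only [box, Finset.mem_filter, Finset.mem_univ, true_and, boxLabel, Subtype.ext_iff,
    funext_iff, Fin.ext_iff]
  refine forall_congr' fun i => ?_
  obtain ⟨q, hq⟩ := y.2 i
  rw [hq]
  constructor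
  · rintro ⟨h1, h2⟩
    congr 1
    apply Nat.div_eq_of_lt_le
    · rw [mul_comm]; exact h1
    · rw [add_mul, one_mul, mul_comm]; exact h2
  · intro h
    have h3 := Nat.div_add_mod (x i : ℕ) N
    have h4 := Nat.mod_lt (x i : ℕ) hN
    omega

/-- `avgAdj` is the adjoint of `avg` for the scalar products
`⟨v, u⟩ = η^d ∑_x conj (v x) * u x` on the cube of spacing `η`, and
`⟨v, u⟩ = (N η)^d ∑_y conj (v y) * u y` on the coarse lattice of spacing `N η`. -/
theorem avgAdj_isAdjoint (d n N : ℕ) (hN : 0 < N) (η : ℝ)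
    (h : CoarseCube d n N → ℂ) (f : Cube d n → ℂ) :
    (((N : ℂ) * (η : ℂ)) ^ d) * ∑ y, conj (h y) * avg d n N f y
      = (η : ℂ) ^ d * ∑ x, conj (avgAdj d n N h x) * f x := by
  have hN' : ((N : ℂ) ^ d) ≠ 0 := pow_ne_zero _ (Nat.cast_ne_zero.mpr hN.ne')
  have key : ∑ x, conj (avgAdj d n N h x) * f x
      = ∑ y : CoarseCube d n N, conj (h y) * ∑ x ∈ box y, f x := by
    rw [← Finset.sum_fiberwise (s := Finset.univ) (g := boxLabel (d := d) (n := n) N)]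
    refine Finset.sum_congr rfl fun y _ => ?_
    rw [Finset.mul_sum]
    have hb : box y = Finset.univ.filter fun x => boxLabel N x = y := by
      ext x
      simp [mem_box_iff hN]
    rw [hb]
    refine Finset.sum_congr rfl fun x hx => ?_
    rw [Finset.mem_filter] at hx
    simp [avgAdj, hx.2]
  rw [key, Finset.mul_sum, Finset.mul_sum]
  refine Finset.sum_congr rfl fun y _ => ?_
  simp only [avg, LinearMap.coe_mk, AddHom.coe_mk, mul_pow]
  field_simp

/-- The sequence `a_j = a (1 - L^{-2}) / (1 - L^{-2 j})`, `j ≥ 1`. -/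
def aSeq (a : ℝ) (L j : ℕ) : ℝ :=
  a * (1 - ((L : ℝ) ^ 2)⁻¹) / (1 - ((L : ℝ) ^ (2 * j))⁻¹)

/-- The lattice spacing `η = L^{-k}`. -/
def spacing (L k : ℕ) : ℝ := ((L : ℝ) ^ k)⁻¹

/-- The operator `-Δ + μ_k + a_k Q_k^* Q_k` on the cube `η {0, …, n-1}^d`, where `η = L^{-k}` and
`μ_k = L^{2k} μ₀`. -/
def hamiltonian (d n L k : ℕ) (a μ₀ : ℝ) : Module.End ℂ (Cube d n → ℂ) :=
  -neumannLaplacian d n (spacing L k)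
    + (((L : ℝ) ^ (2 * k) * μ₀ : ℝ) : ℂ) • (LinearMap.id : Module.End ℂ (Cube d n → ℂ))
    + ((aSeq a L k : ℝ) : ℂ) • (avgAdj d n (L ^ k) ∘ₗ avg d n (L ^ k))

/-- The propagator `G_k(Ω) = (-Δ + μ_k + a_k Q_k^* Q_k)^{-1}`
(a genuine inverse if `hamiltonian` is invertible, zero otherwise). -/
def green (d n L k : ℕ) (a μ₀ : ℝ) : Module.End ℂ (Cube d n → ℂ) :=
  Ring.inverse (hamiltonian d n L k a μ₀)

end LatticeGreen

end

/-!
The theorem follows from a priori estimates for real functions `u` on the cube, in which the spacing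
is `1 / N` with `N = L ^ k`; no Green function is ever constructed. Three mechanisms carry the
proof.

*Small coupling.* Replace `s Q^* Q` by the potential `s θ`, where `θ` (`fill`) is the fraction of
each box that lies in the cube. The maximum principle with a barrier (`abs_le_of_fill_potential`)
bounds `u` by the image of `u` under `-Δ + μ + s θ`, with a constant of order `1 / s`; the barrier is
needed because `θ` degenerates on the boundary layer `x i = n - 1` when `n = L ^ m + 1`. Doubling the
variables, with the two points moved by reflection coupling, bounds the difference quotients
(`abs_sub_update_le`) with a constant of order `1 / √s`. The error `s (θ - Q^* Q) u` only sees the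
oscillation of `u` on boxes of side `1`, hence is of relative size `√s`, and is absorbed if `s` is
small (`small_coupling`).

*Arbitrary coupling.* The supremum bound, tested on eigenvectors, yields a gap in `ℓ²`
(`gap_of_sup_bound`), which only increases with the coupling. The gap survives conjugation with a
slowly varying exponential weight (`weighted_l2_bound`), so that the box averages of `u` are bounded
by the supremum norm of the image of `u`. Then `(a - s) Q^* Q u` may be moved to the right-hand side
of the equation with the small coupling `s` (`AprioriBound.mono_coupling`).

*Decay.* Conjugating with a weight that grows exponentially away from a point and is flat at the
boundary of the cube (`exists_weight`) perturbs the operator by small multiples of `u` and of its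
difference quotients, both of which are controlled (`AprioriBound.weighted`). Multiplication by a
phase and taking real parts (`re_mul_hamiltonian`) transfers the bound to complex functions;
invertibility is injectivity in finite dimension.
-/

open scoped BigOperators ComplexConjugate

noncomputable section

namespace LatticeGreen

variable {d n : ℕ}

/-! ### Real form of the operator, boxes and the maximum principle -/

/-- The neighbour of `x` in direction `i`, on the right if `b = true` and on the left otherwise;
a missing neighbour is replaced by `x` itself (Neumann convention). -/
def nbr (i : Fin d) (b : Bool) (x : Cube d n) : Cube d n :=
  Function.update x i (if b then next (x i) else prev (x i))

/-- The Neumann Laplacian with spacing `1 / N` on real functions. -/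
def lap (N : ℕ) (u : Cube d n → ℝ) (x : Cube d n) : ℝ :=
  (N : ℝ) ^ 2 * ∑ i, ∑ b, (u (nbr i b x) - u x)

/-- The operator `Q^* Q` on real functions. On a box that is cut off by the boundary of the cube it
is the average times the fraction `fill N x` of the box that lies in the cube. -/
def blockAvg (N : ℕ) (u : Cube d n → ℝ) (x : Cube d n) : ℝ :=
  ((N : ℝ) ^ d)⁻¹ * ∑ z ∈ box (boxLabel N x), u z

/-- The fraction of the box of `x` that lies in the cube. -/
def fill (N : ℕ) (x : Cube d n) : ℝ :=
  ((N : ℝ) ^ d)⁻¹ * ((box (boxLabel N x)).card : ℝ)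

/-- The operator `-Δ + μ + a Q^* Q` on real functions. -/
def ham (N : ℕ) (μ a : ℝ) (u : Cube d n → ℝ) (x : Cube d n) : ℝ :=
  -lap N u x + μ * u x + a * blockAvg N u x

theorem nbr_true (i : Fin d) (x : Cube d n) :
    nbr i true x = Function.update x i (next (x i)) := rfl

theorem nbr_false (i : Fin d) (x : Cube d n) :
    nbr i false x = Function.update x i (prev (x i)) := rfl

theorem nbr_ne_imp (i : Fin d) (b : Bool) (x z : Cube d n) (hxz : x ≠ z) (h : nbr i b x = z) :
    nbr i (!b) z = x := by
  subst h
  have hi : nbr i b x i ≠ x i := fun h => hxz (by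
    have h' : (if b then next (x i) else prev (x i)) = x i := by simpa [nbr] using h
    simp [nbr, h'])
  have h1 := (x i).isLt
  have key : (if (!b) then next (nbr i b x i) else prev (nbr i b x i)) = x i := by
    cases b <;> simp [nbr, next, prev, Fin.ext_iff] at hi ⊢ <;> omega
  rw [nbr, key]
  simp [nbr]

theorem nbr_eq_comm (i : Fin d) (b : Bool) (x z : Cube d n) (hxz : x ≠ z) :
    nbr i b x = z ↔ nbr i (!b) z = x :=
  ⟨nbr_ne_imp i b x z hxz, fun h => by simpa using nbr_ne_imp i (!b) z x hxz.symm h⟩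

theorem lap_add (N : ℕ) (u v : Cube d n → ℝ) (x : Cube d n) :
    lap N (u + v) x = lap N u x + lap N v x := by
  simp only [lap, Pi.add_apply, ← mul_add, ← Finset.sum_add_distrib]
  congr 1
  exact Finset.sum_congr rfl fun i _ => Finset.sum_congr rfl fun b _ => by ring

theorem lap_smul (N : ℕ) (c : ℝ) (u : Cube d n → ℝ) (x : Cube d n) :
    lap N (c • u) x = c * lap N u x := by
  simp only [lap, Pi.smul_apply, smul_eq_mul, ← mul_sub, ← Finset.mul_sum]
  ring

theorem mem_box_self {N : ℕ} (hN : 0 < N) (x : Cube d n) : x ∈ box (boxLabel N x) :=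
  (mem_box_iff hN _ _).2 rfl

theorem dist_le_of_mem_box {N : ℕ} {x z : Cube d n} (hN : 0 < N) (hz : z ∈ box (boxLabel N x))
    (i : Fin d) : |((z i : ℕ) : ℝ) - ((x i : ℕ) : ℝ)| ≤ N := by
  have h1 := (Finset.mem_filter.1 hz).2 i
  have h2 := (Finset.mem_filter.1 (mem_box_self hN x)).2 i
  rw [abs_le]
  constructor
  · have : (x i : ℕ) ≤ (z i : ℕ) + N := by omega
    have : ((x i : ℕ) : ℝ) ≤ ((z i : ℕ) : ℝ) + N := by exact_mod_cast this
    linarith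
  · have : (z i : ℕ) ≤ (x i : ℕ) + N := by omega
    have : ((z i : ℕ) : ℝ) ≤ ((x i : ℕ) : ℝ) + N := by exact_mod_cast this
    linarith

theorem box_eq_piFinset {N : ℕ} (y : CoarseCube d n N) :
    box y = Fintype.piFinset fun i =>
      Finset.univ.filter fun j : Fin n => (y.1 i : ℕ) ≤ (j : ℕ) ∧ (j : ℕ) < (y.1 i : ℕ) + N := by
  ext x
  simp [box]

theorem card_segment_le (a N : ℕ) :
    (Finset.univ.filter fun j : Fin n => a ≤ (j : ℕ) ∧ (j : ℕ) < a + N).card ≤ N := by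
  rw [← Finset.card_map Fin.valEmbedding]
  calc _ ≤ (Finset.Ico a (a + N)).card := Finset.card_le_card fun j hj => by
        simp only [Finset.mem_map, Finset.mem_filter, Finset.mem_univ, true_and] at hj
        obtain ⟨t, ht, rfl⟩ := hj
        exact Finset.mem_Ico.2 ht
    _ = N := by simp

theorem card_segment_eq (a N : ℕ) (h : a + N ≤ n) :
    (Finset.univ.filter fun j : Fin n => a ≤ (j : ℕ) ∧ (j : ℕ) < a + N).card = N := by
  rw [← Finset.card_map Fin.valEmbedding]
  calc _ = (Finset.Ico a (a + N)).card := by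
        congr 1
        ext j
        simp only [Finset.mem_map, Finset.mem_filter, Finset.mem_univ, true_and, Finset.mem_Ico]
        constructor
        · rintro ⟨t, ht, rfl⟩
          exact ht
        · intro hj
          exact ⟨⟨j, by omega⟩, hj, rfl⟩
    _ = N := by simp

theorem card_box_le {N : ℕ} (y : CoarseCube d n N) : (box y).card ≤ N ^ d := by
  rw [box_eq_piFinset, Fintype.card_piFinset]
  calc _ ≤ ∏ _i : Fin d, N := Finset.prod_le_prod' fun i _ => card_segment_le _ _
    _ = N ^ d := by simp

theorem fill_le_one {N : ℕ} (hN : 0 < N) (x : Cube d n) : fill N x ≤ 1 := by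
  have hN' : (0 : ℝ) < (N : ℝ) ^ d := by positivity
  rw [fill, inv_mul_le_one₀ hN']
  exact_mod_cast card_box_le _

theorem inv_pow_le_fill {N : ℕ} (hN : 0 < N) (x : Cube d n) : ((N : ℝ) ^ d)⁻¹ ≤ fill N x := by
  have h1 : (1 : ℝ) ≤ ((box (boxLabel N x)).card : ℝ) := by
    exact_mod_cast Finset.card_pos.2 ⟨x, mem_box_self hN x⟩
  have hN' : (0 : ℝ) < ((N : ℝ) ^ d)⁻¹ := by positivity
  rw [fill]
  nlinarith

theorem fill_pos {N : ℕ} (hN : 0 < N) (x : Cube d n) : 0 < fill N x :=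
  lt_of_lt_of_le (by positivity) (inv_pow_le_fill hN x)

theorem fill_eq_one {N : ℕ} (hN : 0 < N) (x : Cube d n)
    (h : ∀ i, N * ((x i : ℕ) / N) + N ≤ n) : fill N x = 1 := by
  have hc : (box (boxLabel N x)).card = N ^ d := by
    rw [box_eq_piFinset, Fintype.card_piFinset]
    calc _ = ∏ _i : Fin d, N := Finset.prod_congr rfl fun i _ => card_segment_eq _ _ (h i)
      _ = N ^ d := by simp
  have hN' : ((N : ℝ) ^ d) ≠ 0 := by positivity
  rw [fill, hc, Nat.cast_pow, inv_mul_cancel₀ hN']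

theorem mul_div_add_le {N q t : ℕ} (h : t < N * q) : N * (t / N) + N ≤ N * q := by
  have : t / N < q := Nat.div_lt_of_lt_mul h
  calc N * (t / N) + N = N * (t / N + 1) := by ring
    _ ≤ N * q := Nat.mul_le_mul_left _ this

/-- The maximum principle for `-Δ + V` with a positive potential. -/
theorem max_principle (N : ℕ) (V w : Cube d n → ℝ) (hV : ∀ x, 0 < V x)
    (h : ∀ x, -lap N w x + V x * w x ≤ 0) (x : Cube d n) : w x ≤ 0 := by
  obtain ⟨x₀, -, hx₀⟩ := Finset.exists_max_image Finset.univ w ⟨x, Finset.mem_univ x⟩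
  have hl : lap N w x₀ ≤ 0 := by
    refine mul_nonpos_of_nonneg_of_nonpos (by positivity) ?_
    exact Finset.sum_nonpos fun i _ => Finset.sum_nonpos fun b _ =>
      sub_nonpos.2 (hx₀ _ (Finset.mem_univ _))
  have h1 : V x₀ * w x₀ ≤ 0 := by linarith [h x₀]
  have h2 : w x₀ ≤ 0 := by
    by_contra! hc
    exact absurd h1 (not_le.2 (mul_pos (hV x₀) hc))
  exact (hx₀ x (Finset.mem_univ x)).trans h2

/-! ### Barriers and the supremum bound -/

/-- The lower bound, relative to the coupling, that the barrier function provides. -/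
def barrierConst (d : ℕ) : ℝ := min (1 / (4 * d)) (1 / (d : ℝ) ^ d)

theorem barrierConst_pos (hd : 1 ≤ d) : 0 < barrierConst d := by
  have : (0 : ℝ) < d := by exact_mod_cast hd
  exact lt_min (by positivity) (by positivity)

theorem barrierConst_le_one (hd : 1 ≤ d) : barrierConst d ≤ 1 := by
  have : (1 : ℝ) ≤ d := by exact_mod_cast hd
  refine (min_le_left _ _).trans ?_
  rw [div_le_one (by positivity)]
  linarith

theorem sum_update_sub (g : Fin d → Fin n → ℝ) (x : Cube d n) (i : Fin d) (v : Fin n) :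
    ∑ j, g j (Function.update x i v j) - ∑ j, g j (x j) = g i v - g i (x i) := by
  rw [← Finset.sum_sub_distrib, Finset.sum_eq_single i]
  · simp
  · intro j _ hj
    simp [Function.update_of_ne hj]
  · simp

/-- The barrier in the case where the boundary layer matters: a quadratic ramp that rises towards
the faces `x i = n - 1` along the last box. Its Laplacian is bounded, and strongly negative on the
faces. -/
theorem ramp_barrier (hd : 1 ≤ d) {N q : ℕ} (hNd : d ≤ N) (hN : 3 ≤ N) (hq : 1 ≤ q)
    (hn : n = N * q + 1) {s : ℝ} (hs : 0 < s) (hs1 : s ≤ 1) :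
    ∃ ψ : Cube d n → ℝ, (∀ x, 1 ≤ ψ x ∧ ψ x ≤ 2) ∧
      ∀ x, s / (4 * d) ≤ -lap N ψ x + s * fill N x * ψ x := by
  have hd' : (1 : ℝ) ≤ d := by exact_mod_cast hd
  have hN' : (3 : ℝ) ≤ N := by exact_mod_cast hN
  have hNd' : (d : ℝ) ≤ N := by exact_mod_cast hNd
  have hNq : N ≤ N * q := Nat.le_mul_of_pos_right _ hq
  set β : ℝ := s / (4 * d) with hβ
  have hβ0 : 0 < β := by positivity
  have hβd : β * (4 * d) = s := by rw [hβ]; field_simp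
  set T : Fin n → ℝ := fun j => (((j : ℕ) - (n - 1 - N) : ℕ) : ℝ) ^ 2 with hT
  set g : Fin d → Fin n → ℝ := fun _ j => β / (N : ℝ) ^ 2 * T j with hg
  have hTN : ∀ j, T j ≤ (N : ℝ) ^ 2 := fun j => by
    have : (j : ℕ) - (n - 1 - N) ≤ N := by omega
    have : ((((j : ℕ) - (n - 1 - N) : ℕ) : ℝ)) ≤ N := by exact_mod_cast this
    simp only [hT]
    gcongr
  have hT0 : ∀ j, 0 ≤ T j := fun j => by positivity
  have hsum0 : ∀ x : Cube d n, 0 ≤ ∑ j, g j (x j) := fun x =>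
    Finset.sum_nonneg fun j _ => mul_nonneg (by positivity) (hT0 _)
  have hsum1 : ∀ x : Cube d n, ∑ j, g j (x j) ≤ 1 := fun x => by
    calc ∑ j, g j (x j) ≤ ∑ _j : Fin d, β := Finset.sum_le_sum fun j _ => by
          simp only [hg]
          rw [div_mul_eq_mul_div, div_le_iff₀ (by positivity)]
          exact mul_le_mul_of_nonneg_left (hTN _) hβ0.le
      _ = d * β := by simp
      _ ≤ 1 := by linarith
  set D : Fin n → ℝ := fun p => ∑ b : Bool, (T (if b then next p else prev p) - T p) with hD
  have hlap : ∀ x : Cube d n, lap N (fun x => 1 + ∑ j, g j (x j)) x = β * ∑ i, D (x i) := by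
    intro x
    simp only [lap, nbr, hD, add_sub_add_left_eq_sub, sum_update_sub]
    simp only [hg, ← mul_sub, ← Finset.mul_sum]
    field_simp
  have hD2 : ∀ p, D p ≤ 2 := by
    intro p
    have hp := p.isLt
    simp only [hD, Fintype.sum_bool, hT, next, prev, if_true, Bool.false_eq_true, if_false]
    obtain ⟨t, ht⟩ : ∃ t, t = (p : ℕ) - (n - 1 - N) := ⟨_, rfl⟩
    have h1 : min ((p : ℕ) + 1) (n - 1) - (n - 1 - N) ≤ t + 1 := by omega
    have h2 : (p : ℕ) - 1 - (n - 1 - N) = t - 1 := by omega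
    rw [h2, ← ht]
    have h1' : ((min ((p : ℕ) + 1) (n - 1) - (n - 1 - N) : ℕ) : ℝ) ≤ t + 1 := by exact_mod_cast h1
    have h1'' : ((min ((p : ℕ) + 1) (n - 1) - (n - 1 - N) : ℕ) : ℝ) ^ 2 ≤ (t + 1 : ℝ) ^ 2 := by
      gcongr
    rcases Nat.eq_zero_or_pos t with h0 | h0
    · simp only [h0, Nat.cast_zero, zero_add, one_pow, Nat.zero_sub] at h1'' ⊢
      linarith
    · rw [Nat.cast_sub h0]
      push_cast
      nlinarith
  have hDlast : ∀ p : Fin n, (p : ℕ) = n - 1 → D p ≤ -(2 * N - 1) := by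
    intro p hp
    simp only [hD, Fintype.sum_bool, hT, next, prev, if_true, Bool.false_eq_true, if_false]
    have h1 : min ((p : ℕ) + 1) (n - 1) - (n - 1 - N) = N := by omega
    have h2 : (p : ℕ) - 1 - (n - 1 - N) = N - 1 := by omega
    have h3 : (p : ℕ) - (n - 1 - N) = N := by omega
    rw [h1, h2, h3, Nat.cast_sub (by omega)]
    push_cast
    nlinarith
  refine ⟨fun x => 1 + ∑ j, g j (x j), fun x => ⟨by linarith [hsum0 x], by linarith [hsum1 x]⟩,
    fun x => ?_⟩
  rw [hlap]
  by_cases hx : ∃ i, ((x i : Fin n) : ℕ) = n - 1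
  · obtain ⟨i, hi⟩ := hx
    have hS : ∑ j, D (x j) ≤ -1 := by
      rw [← Finset.add_sum_erase _ _ (Finset.mem_univ i)]
      have h1 : ∑ j ∈ Finset.univ.erase i, D (x j) ≤ ∑ j ∈ Finset.univ.erase i, (2 : ℝ) :=
        Finset.sum_le_sum fun j _ => hD2 _
      rw [Finset.sum_const, Finset.card_erase_of_mem (Finset.mem_univ i), Finset.card_univ,
        Fintype.card_fin, nsmul_eq_mul, Nat.cast_sub hd] at h1
      have h2 := hDlast _ hi
      push_cast at h1
      linarith
    have h3 : 0 ≤ s * fill N x * (1 + ∑ j, g j (x j)) :=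
      mul_nonneg (mul_nonneg hs.le (fill_pos (by omega) x).le) (by linarith [hsum0 x])
    nlinarith
  · push Not at hx
    have hf : fill N x = 1 := fill_eq_one (by omega) x fun i => by
      have h1 := (x i).isLt
      have h2 := hx i
      have := mul_div_add_le (N := N) (q := q) (t := (x i : ℕ))
      omega
    have hS : ∑ j, D (x j) ≤ 2 * d := by
      calc ∑ j, D (x j) ≤ ∑ _j : Fin d, (2 : ℝ) := Finset.sum_le_sum fun j _ => hD2 _
        _ = 2 * d := by simp [mul_comm]
    rw [hf]
    have h3 : s * 1 ≤ s * 1 * (1 + ∑ j, g j (x j)) :=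
      le_mul_of_one_le_right (by linarith) (by linarith [hsum0 x])
    have h4 : β ≤ s / 4 := by nlinarith
    nlinarith

/-- A supersolution for `-Δ + s θ`, where `θ` is the filling fraction of the boxes. If the boxes are
large, a ramp transports the mass of the full boxes to the boundary layer, where `θ` is small;
otherwise `θ` is bounded below in terms of the dimension. -/
theorem exists_barrier (hd : 1 ≤ d) {N q : ℕ} (hN : 3 ≤ N) (hq : 1 ≤ q)
    (hn : n = N * q + 1 ∨ n = N * q) {s : ℝ} (hs : 0 < s) (hs1 : s ≤ 1) :
    ∃ ψ : Cube d n → ℝ, (∀ x, 1 ≤ ψ x ∧ ψ x ≤ 2) ∧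
      ∀ x, barrierConst d * s ≤ -lap N ψ x + s * fill N x * ψ x := by
  have hd' : (1 : ℝ) ≤ d := by exact_mod_cast hd
  have hconst : ∀ x : Cube d n, lap N (fun _ => (1 : ℝ)) x = 0 := fun x => by simp [lap]
  rcases hn with hn | hn
  · by_cases hNd : d ≤ N
    · obtain ⟨ψ, h1, h2⟩ := ramp_barrier hd hNd hN hq hn hs hs1
      refine ⟨ψ, h1, fun x => le_trans ?_ (h2 x)⟩
      have : barrierConst d ≤ 1 / (4 * d) := min_le_left _ _
      calc barrierConst d * s ≤ 1 / (4 * d) * s := by gcongr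
        _ = s / (4 * d) := by ring
    · refine ⟨fun _ => 1, fun _ => ⟨le_rfl, by norm_num⟩, fun x => ?_⟩
      rw [hconst, neg_zero, zero_add, mul_one, mul_comm]
      refine mul_le_mul_of_nonneg_left ?_ hs.le
      refine (min_le_right _ _).trans (le_trans ?_ (inv_pow_le_fill (by omega) x))
      rw [one_div]
      have : (0 : ℝ) < N := by positivity
      have : (N : ℝ) ≤ d := by exact_mod_cast (not_le.1 hNd).le
      gcongr
  · refine ⟨fun _ => 1, fun _ => ⟨le_rfl, by norm_num⟩, fun x => ?_⟩
    have hf : fill N x = 1 := fill_eq_one (by omega) x fun i => by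
      have h1 := (x i).isLt
      have := mul_div_add_le (N := N) (q := q) (t := (x i : ℕ))
      omega
    rw [hconst, hf]
    have := barrierConst_le_one hd
    nlinarith

/-- The supremum bound for `-Δ + μ + s θ`, by comparison with the barrier. -/
theorem abs_le_of_fill_potential (hd : 1 ≤ d) {N q : ℕ} (hN : 3 ≤ N) (hq : 1 ≤ q)
    (hn : n = N * q + 1 ∨ n = N * q) {s : ℝ} (hs : 0 < s) (hs1 : s ≤ 1) {μ : ℝ} (hμ : 0 ≤ μ)
    (u : Cube d n → ℝ) (A : ℝ) (h : ∀ x, |-lap N u x + (μ + s * fill N x) * u x| ≤ A)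
    (x : Cube d n) : |u x| ≤ 2 / barrierConst d / s * A := by
  have hc := barrierConst_pos hd
  obtain ⟨ψ, hψ, hb⟩ := exists_barrier hd hN hq hn hs hs1
  have hA : 0 ≤ A := (abs_nonneg _).trans (h x)
  set K : ℝ := A / (barrierConst d * s) with hK
  have hK0 : 0 ≤ K := by positivity
  have hKA : K * (barrierConst d * s) = A := by rw [hK]; field_simp
  have key : ∀ v : Cube d n → ℝ, (∀ x, -lap N v x + (μ + s * fill N x) * v x ≤ A) →
      v x ≤ 2 / barrierConst d / s * A := by
    intro v hv
    have h1 := max_principle N (fun x => μ + s * fill N x) (v + (-K) • ψ)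
      (fun x => by have := fill_pos (N := N) (by omega) x; positivity)
      (fun x => by
        simp only [lap_add, lap_smul, Pi.add_apply, Pi.smul_apply, smul_eq_mul]
        have h2 : K * (barrierConst d * s) ≤ K * (-lap N ψ x + s * fill N x * ψ x) :=
          mul_le_mul_of_nonneg_left (hb x) hK0
        have h3 : 0 ≤ K * (μ * ψ x) :=
          mul_nonneg hK0 (mul_nonneg hμ (by linarith [(hψ x).1]))
        have h4 := hv x
        nlinarith) x
    simp only [Pi.add_apply, Pi.smul_apply, smul_eq_mul] at h1
    have h5 : K * ψ x ≤ K * 2 := mul_le_mul_of_nonneg_left (hψ x).2 hK0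
    have h6 : K * 2 = 2 / barrierConst d / s * A := by rw [hK]; field_simp
    linarith
  refine abs_le.2 ⟨?_, key u fun x => (abs_le.1 (h x)).2⟩
  have h2 := key ((-1 : ℝ) • u) fun x => by
    rw [lap_smul]
    simp only [Pi.smul_apply, smul_eq_mul]
    linarith [(abs_le.1 (h x)).1]
  simp only [Pi.smul_apply, smul_eq_mul] at h2
  linarith

/-! ### Gradient bound by doubling of variables -/

theorem concave_step {ρ t : ℝ} (h0 : 0 < ρ) (h : 1 - ρ = t * ρ) (g : ℕ) (hg : 2 ≤ g) :
    (1 - ρ ^ (g + 2)) + (1 - ρ ^ (g - 2)) - 2 * (1 - ρ ^ g) ≤ -(t ^ 2 * ρ ^ g) := by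
  obtain ⟨k, rfl⟩ := Nat.exists_eq_add_of_le' hg
  have hk : 0 < ρ ^ k := pow_pos h0 k
  rw [Nat.add_sub_cancel]
  have e : (1 - ρ ^ (k + 2 + 2)) + (1 - ρ ^ k) - 2 * (1 - ρ ^ (k + 2)) + t ^ 2 * ρ ^ (k + 2)
      = -(ρ ^ k * ((1 - ρ) ^ 2 * (1 + ρ) ^ 2 - (t * ρ) ^ 2)) := by ring
  rw [← h] at e
  have h2 : 0 ≤ (1 - ρ) ^ 2 * (1 + ρ) ^ 2 - (1 - ρ) ^ 2 := by
    have : 0 ≤ (1 - ρ) ^ 2 * (2 * ρ + ρ ^ 2) := by positivity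
    nlinarith
  nlinarith [mul_nonneg hk.le h2]

theorem concave_step_one {ρ t : ℝ} (h0 : 0 < ρ) (h : 1 - ρ = t * ρ) (ht : t ≤ 1) :
    (1 - ρ ^ 3) - 3 * (1 - ρ) ≤ -(t ^ 2 * ρ) := by
  have h2 : 1 / 2 ≤ ρ := by nlinarith
  have e : (1 - ρ ^ 3) - 3 * (1 - ρ) = -((t * ρ) ^ 2 * (2 + ρ)) := by rw [← h]; ring
  rw [e, neg_le_neg_iff]
  have : 0 ≤ t ^ 2 * ρ * (ρ * (2 + ρ) - 1) := mul_nonneg (by positivity) (by nlinarith)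
  nlinarith

/-- Doubling of variables in direction `i`: `x` and `y = update x i q` are moved in opposite
directions along `i` and in parallel along the other axes (reflection coupling), so that the
difference `u x - u y` satisfies a one-dimensional inequality in the gap `q - x i`, for which
`1 - ρ ^ gap` is a supersolution. -/
theorem sub_update_le (N : ℕ) (hN : 1 ≤ N) {s μ : ℝ} (hs : 0 < s) (hs1 : s ≤ 1) (hμ : 0 ≤ μ)
    (u : Cube d n → ℝ) (A : ℝ) (h : ∀ x, |-lap N u x + (μ + s) * u x| ≤ A)
    (i : Fin d) (x : Cube d n) (q : Fin n) (hq : x i ≤ q) :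
    u x - u (Function.update x i q) ≤
      2 * A / √s * (((q : ℕ) : ℝ) - ((x i : ℕ) : ℝ)) / N := by
  have hN' : (1 : ℝ) ≤ N := by exact_mod_cast hN
  have hA : 0 ≤ A := (abs_nonneg _).trans (h x)
  have hr : 0 < √s := Real.sqrt_pos.2 hs
  have hr1 : √s ≤ 1 := Real.sqrt_le_one.2 hs1
  have hrs : √s ^ 2 = s := Real.sq_sqrt hs.le
  -- `ρ = 1 / (1 + √s / N)` makes `K (1 - ρ ^ g)` a supersolution with source `K s = 2 A`
  set t : ℝ := √s / N with ht
  have ht0 : 0 < t := by positivity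
  have ht1 : t ≤ 1 := by rw [ht, div_le_one (by positivity)]; linarith
  have hts : (N : ℝ) ^ 2 * t ^ 2 = s := by rw [ht, div_pow, hrs]; field_simp
  set ρ : ℝ := 1 / (1 + t) with hρ
  have hρ0 : 0 < ρ := by positivity
  have hρ1 : ρ ≤ 1 := by rw [hρ, div_le_one (by positivity)]; linarith
  have hρt : 1 - ρ = t * ρ := by rw [hρ]; field_simp; ring
  set K : ℝ := 2 * A / s with hK
  have hK0 : 0 ≤ K := by positivity
  have hKs : K * s = 2 * A := by rw [hK]; field_simp
  set φ : ℕ → ℝ := fun g => K * (1 - ρ ^ g) with hφ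
  have hφm : ∀ {g g' : ℕ}, g ≤ g' → φ g ≤ φ g' := fun {g g'} hgg => by
    have := pow_le_pow_of_le_one hρ0.le hρ1 hgg
    exact mul_le_mul_of_nonneg_left (by linarith) hK0
  have hφ0 : ∀ g, 0 ≤ φ g := fun g =>
    mul_nonneg hK0 (sub_nonneg.2 (pow_le_one₀ hρ0.le hρ1))
  -- the maximum of `u x - u (update x i q) - φ (q - x i)` over all pairs is not positive
  have key : ∀ p : Cube d n × Fin n, p.1 i ≤ p.2 →
      u p.1 - u (Function.update p.1 i p.2) - φ ((p.2 : ℕ) - (p.1 i : ℕ)) ≤ 0 := by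
    set S : Finset (Cube d n × Fin n) := Finset.univ.filter fun p => p.1 i ≤ p.2 with hS
    obtain ⟨⟨y, r⟩, hyr, hmax⟩ := Finset.exists_max_image S
      (fun p => u p.1 - u (Function.update p.1 i p.2) - φ ((p.2 : ℕ) - (p.1 i : ℕ)))
      ⟨(x, q), by simp [hS, hq]⟩
    have hyr' : y i ≤ r := by simpa [hS] using hyr
    suffices hF : u y - u (Function.update y i r) - φ ((r : ℕ) - (y i : ℕ)) ≤ 0 from
      fun p hp => (hmax p (by simp [hS, hp])).trans hF
    by_contra! hF
    set z := Function.update y i r with hz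
    obtain ⟨g, hg⟩ : ∃ g, g = (r : ℕ) - (y i : ℕ) := ⟨_, rfl⟩
    have hle : (y i : ℕ) ≤ (r : ℕ) := hyr'
    have hr' := r.isLt
    rw [← hg] at hF
    have hg0 : g ≠ 0 := by
      intro h0
      have : r = y i := Fin.ext (by omega)
      rw [hz, this, Function.update_eq_self] at hF
      linarith [hφ0 g]
    have hmax' : ∀ (y' : Cube d n) (r' : Fin n), y' i ≤ r' →
        u y' - u (Function.update y' i r') ≤ u y - u z + (φ ((r' : ℕ) - (y' i : ℕ)) - φ g) := by
      intro y' r' h'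
      have := hmax (y', r') (by simp [hS, h'])
      simp only at this
      rw [← hg] at this
      linarith
    -- parallel moves preserve the gap; opposite moves along `i` change it by at most two, and less
    -- than that only at the boundary, where the monotonicity of `φ` makes up for it
    have hother : ∀ j ≠ i, ∑ b, (u (nbr j b y) - u y) - ∑ b, (u (nbr j b z) - u z) ≤ 0 := by
      intro j hj
      rw [← Finset.sum_sub_distrib]
      refine Finset.sum_nonpos fun b _ => ?_
      have e1 : nbr j b z = Function.update (nbr j b y) i r := by
        simp only [nbr, hz, Function.update_of_ne hj]
        rw [Function.update_comm hj.symm]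
      have e2 : nbr j b y i = y i := by simp [nbr, Function.update_of_ne hj.symm]
      have := hmax' (nbr j b y) r (by rw [e2]; exact hyr')
      rw [e2, ← e1, ← hg, sub_self, add_zero] at this
      linarith
    have hdir : ∑ b, (u (nbr i b y) - u y) - ∑ b, (u (nbr i b z) - u z) ≤
        K * (-(t ^ 2 * ρ ^ g)) := by
      have e3 : ∀ b, nbr i b z = Function.update y i (if b then next r else prev r) := by
        intro b
        simp [nbr, hz]
      simp only [Fintype.sum_bool, e3, if_true, Bool.false_eq_true, if_false]
      have hout : u (nbr i false y) - u (Function.update y i (next r)) ≤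
          u y - u z + (φ (g + 2) - φ g) := by
        have h1 := hmax' (nbr i false y) (next r) (by
          simp only [nbr, Function.update_self, prev, next, Fin.le_def, Bool.false_eq_true,
            if_false]
          omega)
        have h2 : φ ((next r : ℕ) - (nbr i false y i : ℕ)) ≤ φ (g + 2) := hφm (by
          simp only [nbr, Function.update_self, prev, next, Bool.false_eq_true, if_false]
          omega)
        have h3 : Function.update (nbr i false y) i (next r) = Function.update y i (next r) := by
          simp [nbr]
        rw [h3] at h1
        linarith
      rcases Nat.lt_or_ge g 2 with hg2 | hg2
      · -- gap one: the inner move exchanges the two points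
        have hg1 : g = 1 := by omega
        have e4 : nbr i true y = z := by
          rw [hz, nbr_true]
          congr 1
          simp only [next, Fin.ext_iff]
          omega
        have e5 : Function.update y i (prev r) = y := by
          have : prev r = y i := by
            simp only [prev, Fin.ext_iff]
            omega
          rw [this, Function.update_eq_self]
        rw [e4, e5]
        rw [hg1] at hout hF ⊢
        have h6 := mul_le_mul_of_nonneg_left (concave_step_one hρ0 hρt ht1) hK0
        simp only [hφ, pow_one] at hout hF h6 ⊢
        norm_num at hout
        linarith
      · have h1 := hmax' (nbr i true y) (prev r) (by
          simp only [nbr, Function.update_self, prev, next, Fin.le_def, if_true]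
          omega)
        have h2 : φ ((prev r : ℕ) - (nbr i true y i : ℕ)) = φ (g - 2) := by
          congr 1
          simp only [nbr, Function.update_self, prev, next, if_true]
          omega
        have h3 : Function.update (nbr i true y) i (prev r) = Function.update y i (prev r) := by
          simp [nbr]
        rw [h2, h3] at h1
        have h6 := mul_le_mul_of_nonneg_left (concave_step hρ0 hρt g hg2) hK0
        simp only [hφ] at hout h1 h6
        linarith
    have hlap : lap N u y - lap N u z ≤ -(K * s * ρ ^ g) := by
      have e : lap N u y - lap N u z = (N : ℝ) ^ 2 *
          ∑ j, (∑ b, (u (nbr j b y) - u y) - ∑ b, (u (nbr j b z) - u z)) := by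
        simp only [lap, Finset.sum_sub_distrib]
        ring
      have h1 : ∑ j, (∑ b, (u (nbr j b y) - u y) - ∑ b, (u (nbr j b z) - u z)) ≤
          K * (-(t ^ 2 * ρ ^ g)) := by
        rw [← Finset.add_sum_erase _ _ (Finset.mem_univ i)]
        have : ∑ j ∈ Finset.univ.erase i,
            (∑ b, (u (nbr j b y) - u y) - ∑ b, (u (nbr j b z) - u z)) ≤ 0 :=
          Finset.sum_nonpos fun j hj => hother j (Finset.ne_of_mem_erase hj)
        linarith
      rw [e]
      calc _ ≤ (N : ℝ) ^ 2 * (K * (-(t ^ 2 * ρ ^ g))) :=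
            mul_le_mul_of_nonneg_left h1 (by positivity)
        _ = -(K * ((N : ℝ) ^ 2 * t ^ 2) * ρ ^ g) := by ring
        _ = _ := by rw [hts]
    have hy := (abs_le.1 (h y)).2
    have hz' := (abs_le.1 (h z)).1
    have hφg : φ g < u y - u z := by linarith
    have h7 : s * φ g < (μ + s) * (u y - u z) := by
      have := hφ0 g
      nlinarith
    have h8 : s * φ g + K * s * ρ ^ g = 2 * A := by
      rw [← hKs]
      simp only [hφ]
      ring
    nlinarith
  have h1 := key (x, q) hq
  simp only at h1
  have h2 : 1 - ρ ^ ((q : ℕ) - (x i : ℕ)) ≤ (((q : ℕ) : ℝ) - ((x i : ℕ) : ℝ)) * t := by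
    have h3 := one_add_mul_le_pow (a := ρ - 1) (by linarith) ((q : ℕ) - (x i : ℕ))
    rw [Nat.cast_sub hq] at h3
    have h4 : (0 : ℝ) ≤ ((q : ℕ) : ℝ) - ((x i : ℕ) : ℝ) := by
      have : ((x i : ℕ) : ℝ) ≤ ((q : ℕ) : ℝ) := by exact_mod_cast hq
      linarith
    have h5 : 1 - ρ ≤ t := by rw [hρt]; nlinarith
    have h6 := mul_le_mul_of_nonneg_left h5 h4
    have e : 1 + (ρ - 1) = ρ := by ring
    rw [e] at h3
    linarith
  calc u x - u (Function.update x i q) ≤ K * (1 - ρ ^ ((q : ℕ) - (x i : ℕ))) := by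
        simp only [hφ] at h1
        linarith
    _ ≤ K * ((((q : ℕ) : ℝ) - ((x i : ℕ) : ℝ)) * t) := mul_le_mul_of_nonneg_left h2 hK0
    _ = _ := by
        rw [hK, ht]
        field_simp
        rw [hrs]
        ring

/-- The Lipschitz bound in each coordinate direction for solutions of `-Δu + (μ + s) u = f`. -/
theorem abs_sub_update_le (N : ℕ) (hN : 1 ≤ N) {s μ : ℝ} (hs : 0 < s) (hs1 : s ≤ 1) (hμ : 0 ≤ μ)
    (u : Cube d n → ℝ) (A : ℝ) (h : ∀ x, |-lap N u x + (μ + s) * u x| ≤ A)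
    (i : Fin d) (x : Cube d n) (q : Fin n) :
    |u x - u (Function.update x i q)| ≤
      2 * A / √s * |((q : ℕ) : ℝ) - ((x i : ℕ) : ℝ)| / N := by
  have key : ∀ v : Cube d n → ℝ, (∀ x, |-lap N v x + (μ + s) * v x| ≤ A) →
      v x - v (Function.update x i q) ≤
        2 * A / √s * |((q : ℕ) : ℝ) - ((x i : ℕ) : ℝ)| / N := by
    intro v hv
    have hvn : ∀ x, |-lap N ((-1 : ℝ) • v) x + (μ + s) * ((-1 : ℝ) • v) x| ≤ A := fun x => by
      rw [lap_smul, ← abs_neg]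
      simp only [Pi.smul_apply, smul_eq_mul]
      convert hv x using 2
      ring
    rcases le_total (x i) q with hq | hq
    · have hq' : ((x i : ℕ) : ℝ) ≤ ((q : ℕ) : ℝ) := by exact_mod_cast hq
      rw [abs_of_nonneg (by linarith)]
      exact sub_update_le N hN hs hs1 hμ v A hv i x q hq
    · have hq' : ((q : ℕ) : ℝ) ≤ ((x i : ℕ) : ℝ) := by exact_mod_cast hq
      have h1 := sub_update_le N hN hs hs1 hμ _ A hvn i (Function.update x i q) (x i)
        (by simpa using hq)
      simp only [Function.update_idem, Function.update_eq_self, Function.update_self,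
        Pi.smul_apply, smul_eq_mul] at h1
      rw [abs_sub_comm, abs_of_nonneg (by linarith)]
      linarith
  have h1 := key u h
  have h2 := key ((-1 : ℝ) • u) fun x => by
    rw [lap_smul, ← abs_neg]
    simp only [Pi.smul_apply, smul_eq_mul]
    convert h x using 2
    ring
  simp only [Pi.smul_apply, smul_eq_mul] at h2
  exact abs_le.2 ⟨by linarith, h1⟩

/-- Coordinatewise Lipschitz bounds add up along a path that changes one coordinate at a time. -/
theorem abs_sub_le_sum_of_update (u : Cube d n → ℝ) (B : ℝ)
    (h : ∀ i x q, |u x - u (Function.update x i q)| ≤ B * |((q : ℕ) : ℝ) - ((x i : ℕ) : ℝ)|)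
    (x z : Cube d n) : |u x - u z| ≤ ∑ i, B * |((z i : ℕ) : ℝ) - ((x i : ℕ) : ℝ)| := by
  have key : ∀ S : Finset (Fin d), |u x - u (S.piecewise z x)| ≤
      ∑ i ∈ S, B * |((z i : ℕ) : ℝ) - ((x i : ℕ) : ℝ)| := by
    intro S
    induction S using Finset.induction_on with
    | empty => simp
    | insert i S hi ih =>
      rw [Finset.sum_insert hi, Finset.piecewise_insert]
      have h1 := h i (S.piecewise z x) (z i)
      rw [Finset.piecewise_eq_of_notMem _ _ _ hi] at h1
      calc _ ≤ |u x - u (S.piecewise z x)| + _ := abs_sub_le _ (u (S.piecewise z x)) _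
        _ ≤ _ := by linarith
  simpa using key Finset.univ

/-! ### A priori bound for small coupling -/

/-- The a priori bound with constant `C` for the operator `-Δ + μ + a Q^* Q` on all admissible cubes:
the supremum norms of `u` and of its difference quotients are controlled by that of the image of
`u`. The constant does not depend on the spacing, the size of the cube or `μ`. -/
def AprioriBound (d : ℕ) (a C : ℝ) : Prop :=
  ∀ (N q n : ℕ), 3 ≤ N → 1 ≤ q → (n = N * q + 1 ∨ n = N * q) → ∀ μ : ℝ, 0 ≤ μ →
    ∀ (u : Cube d n → ℝ) (A : ℝ), (∀ x, |ham N μ a u x| ≤ A) →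
      ∀ x, |u x| ≤ C * A ∧ ∀ i b, |u (nbr i b x) - u x| ≤ C / N * A

theorem abs_next_or_prev_sub_le (p : Fin n) (b : Bool) :
    |(((if b then next p else prev p : Fin n) : ℕ) : ℝ) - ((p : ℕ) : ℝ)| ≤ 1 := by
  have hp := p.isLt
  rw [abs_le]
  cases b
  · simp only [prev, Bool.false_eq_true, if_false]
    have h1 : (p : ℕ) ≤ ((p : ℕ) - 1) + 1 := by omega
    have h2 : ((p : ℕ) - 1) ≤ (p : ℕ) := by omega
    have h1' : ((p : ℕ) : ℝ) ≤ (((p : ℕ) - 1 : ℕ) : ℝ) + 1 := by exact_mod_cast h1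
    have h2' : (((p : ℕ) - 1 : ℕ) : ℝ) ≤ ((p : ℕ) : ℝ) := by exact_mod_cast h2
    constructor <;> linarith
  · simp only [next, if_true]
    have h1 : (p : ℕ) ≤ min ((p : ℕ) + 1) (n - 1) := by omega
    have h2 : min ((p : ℕ) + 1) (n - 1) ≤ (p : ℕ) + 1 := by omega
    have h1' : ((p : ℕ) : ℝ) ≤ ((min ((p : ℕ) + 1) (n - 1) : ℕ) : ℝ) := by exact_mod_cast h1
    have h2' : ((min ((p : ℕ) + 1) (n - 1) : ℕ) : ℝ) ≤ ((p : ℕ) : ℝ) + 1 := by exact_mod_cast h2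
    constructor <;> linarith

theorem fill_mul_sub_blockAvg (N : ℕ) (u : Cube d n → ℝ) (x : Cube d n) :
    fill N x * u x - blockAvg N u x =
      ((N : ℝ) ^ d)⁻¹ * ∑ z ∈ box (boxLabel N x), (u x - u z) := by
  simp only [fill, blockAvg, Finset.sum_sub_distrib, Finset.sum_const, nsmul_eq_mul]
  ring

theorem abs_fill_mul_sub_blockAvg_le {N : ℕ} (hN : 0 < N) (u : Cube d n → ℝ) (x : Cube d n)
    (E : ℝ) (hE : ∀ z ∈ box (boxLabel N x), |u x - u z| ≤ E) :
    |fill N x * u x - blockAvg N u x| ≤ E := by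
  have hE0 : 0 ≤ E := (abs_nonneg _).trans (hE x (mem_box_self hN x))
  rw [fill_mul_sub_blockAvg, abs_mul, abs_of_nonneg (by positivity)]
  calc _ ≤ ((N : ℝ) ^ d)⁻¹ * ∑ z ∈ box (boxLabel N x), E := by
        refine mul_le_mul_of_nonneg_left ?_ (by positivity)
        exact (Finset.abs_sum_le_sum_abs _ _).trans (Finset.sum_le_sum hE)
    _ = fill N x * E := by
        simp only [fill, Finset.sum_const, nsmul_eq_mul]
        ring
    _ ≤ E := mul_le_of_le_one_left hE0 (fill_le_one hN x)

/-- For a small coupling `s` the operator is a perturbation of `-Δ + μ + s θ`: the difference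
`s (θ - Q^* Q)` sees only the oscillation of `u` on the boxes, which the gradient bound makes small
compared with the image of `u`. -/
theorem small_coupling (hd : 1 ≤ d) : ∃ s₀ : ℝ, 0 < s₀ ∧ s₀ ≤ 1 ∧
    ∀ s, 0 < s → s ≤ s₀ → ∃ C, 0 < C ∧ AprioriBound d s C := by
  have hd' : (1 : ℝ) ≤ d := by exact_mod_cast hd
  have hb := barrierConst_pos hd
  obtain ⟨c, hc⟩ : ∃ c, c = 2 / barrierConst d := ⟨_, rfl⟩
  have hc0 : 0 < c := by rw [hc]; positivity
  have h4 : 1 ≤ 4 * d * (1 + c) := by nlinarith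
  refine ⟨(1 / (4 * d * (1 + c))) ^ 2, by positivity, ?_, fun s hs hss => ?_⟩
  · exact pow_le_one₀ (by positivity) (by rw [div_le_one (by positivity)]; exact h4)
  have hs1 : s ≤ 1 := hss.trans
    (pow_le_one₀ (by positivity) (by rw [div_le_one (by positivity)]; exact h4))
  have hr : 0 < √s := Real.sqrt_pos.2 hs
  have hrs : √s * √s = s := Real.mul_self_sqrt hs.le
  have hr1 : √s * (4 * d * (1 + c)) ≤ 1 := by
    have : √s ≤ 1 / (4 * d * (1 + c)) := Real.sqrt_le_iff.2 ⟨by positivity, hss⟩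
    rwa [le_div_iff₀ (by positivity)] at this
  refine ⟨2 * c / s + 4 * (1 + c) / √s, by positivity, ?_⟩
  intro N q n hN hq hn μ hμ u A hA x
  have hA0 : 0 ≤ A := (abs_nonneg _).trans (hA x)
  have hN0 : 0 < N := by omega
  have hNr : (0 : ℝ) < N := by exact_mod_cast hN0
  set v : Cube d n → ℝ := fun x => fill N x * u x - blockAvg N u x with hv
  have hvx : ∀ x, |v x| ≤ ‖v‖ := fun x => norm_le_pi_norm v x
  set A' : ℝ := A + s * ‖v‖ with hA'
  have hA'0 : 0 ≤ A' := by positivity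
  have h1 : ∀ x, |-lap N u x + (μ + s * fill N x) * u x| ≤ A' := fun x => by
    have e : -lap N u x + (μ + s * fill N x) * u x = ham N μ s u x + s * v x := by
      simp only [ham, hv]
      ring
    rw [e]
    refine (abs_add_le _ _).trans (add_le_add (hA x) ?_)
    rw [abs_mul, abs_of_pos hs]
    exact mul_le_mul_of_nonneg_left (hvx x) hs.le
  have h2 : ∀ x, |u x| ≤ c / s * A' := fun x => by
    rw [hc]
    exact abs_le_of_fill_potential hd hN hq hn hs hs1 hμ u A' h1 x
  have h3 : ∀ x, |-lap N u x + (μ + s) * u x| ≤ (1 + c) * A' := fun x => by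
    have e : -lap N u x + (μ + s) * u x =
        (-lap N u x + (μ + s * fill N x) * u x) + s * ((1 - fill N x) * u x) := by ring
    have hf1 := fill_le_one hN0 x
    have hf0 := (fill_pos hN0 x).le
    have h5 : |s * ((1 - fill N x) * u x)| ≤ c * A' := by
      rw [abs_mul, abs_mul, abs_of_pos hs, abs_of_nonneg (by linarith : 0 ≤ 1 - fill N x)]
      calc s * ((1 - fill N x) * |u x|) ≤ s * (1 * (c / s * A')) := by
            gcongr
            · linarith
            · exact h2 x
        _ = c * A' := by field_simp
    rw [e]
    refine (abs_add_le _ _).trans ?_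
    linarith [h1 x]
  have hlip := abs_sub_update_le N (by omega) hs hs1 hμ u _ h3
  have hosc : ∀ x, |v x| ≤ 2 * d * (1 + c) * A' / √s := fun x => by
    refine abs_fill_mul_sub_blockAvg_le hN0 u x _ fun z hz => ?_
    have h6 := abs_sub_le_sum_of_update u (2 * ((1 + c) * A') / √s / N)
      (fun i x q => by
        refine (hlip i x q).trans (le_of_eq ?_)
        ring) x z
    refine h6.trans ?_
    calc _ ≤ ∑ _i : Fin d, 2 * ((1 + c) * A') / √s / N * N :=
          Finset.sum_le_sum fun i _ =>
            mul_le_mul_of_nonneg_left (dist_le_of_mem_box hN0 hz i) (by positivity)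
      _ = 2 * d * (1 + c) * A' / √s := by
          simp only [Finset.sum_const, Finset.card_univ, Fintype.card_fin, nsmul_eq_mul]
          field_simp
  have hvn : ‖v‖ ≤ 2 * d * (1 + c) * A' / √s :=
    (pi_norm_le_iff_of_nonneg (by positivity)).2 hosc
  have h7 : s * ‖v‖ ≤ A' / 2 := by
    calc s * ‖v‖ ≤ s * (2 * d * (1 + c) * A' / √s) := by gcongr
      _ = (√s * (4 * d * (1 + c))) * (A' / 2) := by
          nth_rewrite 1 [← hrs]
          field_simp
          ring
      _ ≤ 1 * (A' / 2) := by gcongr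
      _ = A' / 2 := one_mul _
  have h8 : A' ≤ 2 * A := by linarith
  refine ⟨?_, fun i b => ?_⟩
  · calc |u x| ≤ c / s * A' := h2 x
      _ ≤ c / s * (2 * A) := by gcongr
      _ = 2 * c / s * A := by ring
      _ ≤ _ := by
        gcongr
        have : 0 < 4 * (1 + c) / √s := by positivity
        linarith
  · rw [abs_sub_comm]
    calc _ ≤ _ := hlip i x (if b then next (x i) else prev (x i))
      _ ≤ 2 * ((1 + c) * (2 * A)) / √s * 1 / N := by
        gcongr
        exact abs_next_or_prev_sub_le _ _
      _ = 4 * (1 + c) / √s / N * A := by ring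
      _ ≤ _ := by
        gcongr
        have : 0 < 2 * c / s := by positivity
        linarith

/-! ### Symmetry, spectral gap and weighted `ℓ²` bound -/

/-- The number of ways in which `z` is a neighbour of `x`. -/
def adjCount (x z : Cube d n) : ℝ := ∑ i, ∑ b, if nbr i b x = z then 1 else 0

/-- The matrix of the operator `-Δ + μ + a Q^* Q`. -/
def hamMatrix (N : ℕ) (μ a : ℝ) : Matrix (Cube d n) (Cube d n) ℝ := fun x z =>
  (if x = z then μ + 2 * d * (N : ℝ) ^ 2 else 0) - (N : ℝ) ^ 2 * adjCount x z +
    a * (((N : ℝ) ^ d)⁻¹ * if boxLabel N x = boxLabel N z then 1 else 0)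

theorem adjCount_nonneg (x z : Cube d n) : 0 ≤ adjCount x z :=
  Finset.sum_nonneg fun i _ => Finset.sum_nonneg fun b _ => by split_ifs <;> norm_num

theorem adjCount_comm (x z : Cube d n) : adjCount x z = adjCount z x := by
  rcases eq_or_ne x z with rfl | h
  · rfl
  · simp only [adjCount, Fintype.sum_bool]
    refine Finset.sum_congr rfl fun i _ => ?_
    simp only [nbr_eq_comm i true x z h, nbr_eq_comm i false x z h, Bool.not_true, Bool.not_false]
    ring

theorem sum_adjCount_mul (x : Cube d n) (F : Cube d n → ℝ) :
    ∑ z, adjCount x z * F z = ∑ i, ∑ b, F (nbr i b x) := by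
  simp only [adjCount, Finset.sum_mul]
  rw [Finset.sum_comm]
  refine Finset.sum_congr rfl fun i _ => ?_
  rw [Finset.sum_comm]
  refine Finset.sum_congr rfl fun b _ => ?_
  simp

theorem sum_sameBox_mul {N : ℕ} (hN : 0 < N) (x : Cube d n) (F : Cube d n → ℝ) :
    ∑ z, (if boxLabel N x = boxLabel N z then 1 else 0) * F z = ∑ z ∈ box (boxLabel N x), F z := by
  have : box (boxLabel N x) = Finset.univ.filter fun z => boxLabel N x = boxLabel N z := by
    ext z
    simp [mem_box_iff hN, eq_comm]
  rw [this, Finset.sum_filter]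
  exact Finset.sum_congr rfl fun z _ => by split_ifs <;> simp

theorem hamMatrix_mulVec {N : ℕ} (hN : 0 < N) (μ a : ℝ) (u : Cube d n → ℝ) (x : Cube d n) :
    (hamMatrix N μ a).mulVec u x = ham N μ a u x := by
  have e : (hamMatrix N μ a).mulVec u x =
      ∑ z, (if x = z then μ + 2 * d * (N : ℝ) ^ 2 else 0) * u z -
        (N : ℝ) ^ 2 * ∑ z, adjCount x z * u z + a * (((N : ℝ) ^ d)⁻¹ *
          ∑ z, (if boxLabel N x = boxLabel N z then 1 else 0) * u z) := by
    simp only [Matrix.mulVec, dotProduct, hamMatrix, Finset.mul_sum, ← Finset.sum_sub_distrib,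
      ← Finset.sum_add_distrib]
    exact Finset.sum_congr rfl fun z _ => by ring
  rw [e, sum_adjCount_mul, sum_sameBox_mul hN]
  simp only [ite_mul, zero_mul, Finset.sum_ite_eq, Finset.mem_univ, if_true, ham, lap, blockAvg,
    Finset.sum_sub_distrib, Finset.sum_const, Finset.card_univ, Fintype.card_fin,
    Fintype.card_bool, nsmul_eq_mul]
  push_cast
  ring

theorem hamMatrix_comm (N : ℕ) (μ a : ℝ) (x z : Cube d n) :
    hamMatrix N μ a x z = hamMatrix N μ a z x := by
  simp only [hamMatrix, adjCount_comm x z, eq_comm]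

/-- Symmetric nonnegative jump rates generate a nonnegative Dirichlet form. -/
theorem dirichlet_nonneg {ι : Type*} [Fintype ι] (K : ι → ι → ℝ) (hK : ∀ x z, 0 ≤ K x z)
    (hsymm : ∀ x z, K x z = K z x) (w : ι → ℝ) :
    0 ≤ ∑ x, ∑ z, K x z * (w x * (w x - w z)) := by
  have h1 : ∑ x, ∑ z, K x z * (w x * (w x - w z)) = ∑ x, ∑ z, K x z * (w z * (w z - w x)) := by
    rw [Finset.sum_comm]
    exact Finset.sum_congr rfl fun x _ => Finset.sum_congr rfl fun z _ => by rw [hsymm]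
  have h2 : 2 * ∑ x, ∑ z, K x z * (w x * (w x - w z)) = ∑ x, ∑ z, K x z * (w x - w z) ^ 2 := by
    rw [two_mul]
    nth_rewrite 2 [h1]
    simp only [← Finset.sum_add_distrib]
    exact Finset.sum_congr rfl fun x _ => Finset.sum_congr rfl fun z _ => by ring
  have h3 : 0 ≤ ∑ x, ∑ z, K x z * (w x - w z) ^ 2 :=
    Finset.sum_nonneg fun x _ => Finset.sum_nonneg fun z _ => mul_nonneg (hK x z) (sq_nonneg _)
  linarith

theorem sum_mul_lap_nonpos (N : ℕ) (w : Cube d n → ℝ) : ∑ x, w x * lap N w x ≤ 0 := by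
  have h := dirichlet_nonneg adjCount adjCount_nonneg (adjCount_comm (d := d) (n := n)) w
  have e : ∑ x, w x * lap N w x =
      -((N : ℝ) ^ 2 * ∑ x, ∑ z, adjCount x z * (w x * (w x - w z))) := by
    simp only [sum_adjCount_mul, lap, Finset.mul_sum, ← Finset.sum_neg_distrib]
    exact Finset.sum_congr rfl fun x _ => Finset.sum_congr rfl fun i _ =>
      Finset.sum_congr rfl fun b _ => by ring
  rw [e]
  have : 0 ≤ (N : ℝ) ^ 2 * ∑ x, ∑ z, adjCount x z * (w x * (w x - w z)) := by positivity
  linarith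

theorem sum_mul_blockAvg_nonneg {N : ℕ} (hN : 0 < N) (w : Cube d n → ℝ) :
    0 ≤ ∑ x, w x * blockAvg N w x := by
  rw [← Finset.sum_fiberwise (s := Finset.univ) (g := boxLabel (d := d) (n := n) N)]
  refine Finset.sum_nonneg fun y _ => ?_
  have hb : (Finset.univ.filter fun x => boxLabel N x = y) = box y := by
    ext x
    simp [mem_box_iff hN]
  have e : ∑ x ∈ box y, w x * blockAvg N w x =
      ((N : ℝ) ^ d)⁻¹ * ((∑ x ∈ box y, w x) * ∑ x ∈ box y, w x) := by
    rw [Finset.sum_mul, Finset.mul_sum]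
    refine Finset.sum_congr rfl fun x hx => ?_
    rw [blockAvg, (mem_box_iff hN y x).1 hx]
    ring
  rw [hb, e]
  exact mul_nonneg (by positivity) (mul_self_nonneg _)

theorem sum_mul_ham_nonneg {N : ℕ} (hN : 0 < N) {μ a : ℝ} (hμ : 0 ≤ μ) (ha : 0 ≤ a)
    (w : Cube d n → ℝ) : 0 ≤ ∑ x, w x * ham N μ a w x := by
  have e : ∑ x, w x * ham N μ a w x = -∑ x, w x * lap N w x + μ * ∑ x, w x ^ 2 +
      a * ∑ x, w x * blockAvg N w x := by
    simp only [ham, Finset.mul_sum, ← Finset.sum_neg_distrib, ← Finset.sum_add_distrib]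
    exact Finset.sum_congr rfl fun x _ => by ring
  have h1 := sum_mul_lap_nonpos N w
  have h2 := mul_nonneg ha (sum_mul_blockAvg_nonneg hN w)
  have h3 : 0 ≤ μ * ∑ x, w x ^ 2 := by positivity
  linarith

theorem sum_mul_ham_mono {N : ℕ} (hN : 0 < N) {μ s a : ℝ} (hsa : s ≤ a) (w : Cube d n → ℝ) :
    ∑ x, w x * ham N μ s w x ≤ ∑ x, w x * ham N μ a w x := by
  have e : ∑ x, w x * ham N μ a w x = ∑ x, w x * ham N μ s w x +
      (a - s) * ∑ x, w x * blockAvg N w x := by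
    simp only [ham, Finset.mul_sum, ← Finset.sum_add_distrib]
    exact Finset.sum_congr rfl fun x _ => by ring
  have := mul_nonneg (sub_nonneg.2 hsa) (sum_mul_blockAvg_nonneg hN w)
  linarith

/-- For a symmetric nonnegative matrix, invertibility in the supremum norm with constant `C` implies
a spectral gap `1 / C`: the supremum norm can be tested on eigenvectors. -/
theorem gap_of_sup_bound {ι : Type*} [Fintype ι] [DecidableEq ι] (M : Matrix ι ι ℝ)
    (hsymm : ∀ x z, M x z = M z x) (hpos : ∀ w, 0 ≤ ∑ x, w x * M.mulVec w x) {C : ℝ} (hC : 0 < C)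
    (hsup : ∀ (u : ι → ℝ) (A : ℝ), (∀ x, |M.mulVec u x| ≤ A) → ∀ x, |u x| ≤ C * A) (w : ι → ℝ) :
    C⁻¹ * ∑ x, w x ^ 2 ≤ ∑ x, w x * M.mulVec w x := by
  have hH : (M - C⁻¹ • (1 : Matrix ι ι ℝ)).IsHermitian := by
    refine Matrix.IsHermitian.ext fun x z => ?_
    simp only [Matrix.sub_apply, Matrix.smul_apply, Matrix.one_apply, star_trivial, hsymm x z,
      eq_comm]
  have hP : (M - C⁻¹ • (1 : Matrix ι ι ℝ)).PosSemidef := by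
    rw [hH.posSemidef_iff_eigenvalues_nonneg]
    intro j
    set v : ι → ℝ := ⇑(hH.eigenvectorBasis j) with hv
    set l : ℝ := hH.eigenvalues j with hl
    have hv0 : v ≠ 0 := by
      intro h0
      have h1 := hH.eigenvectorBasis.orthonormal.ne_zero j
      apply h1
      ext x
      exact congrFun h0 x
    have hMv : M.mulVec v = (l + C⁻¹) • v := by
      have h1 := hH.mulVec_eigenvectorBasis j
      rw [Matrix.sub_mulVec, Matrix.smul_mulVec, Matrix.one_mulVec] at h1
      rw [add_smul]
      exact sub_eq_iff_eq_add.1 h1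
    have hnorm : 0 < ‖v‖ := norm_pos_iff.2 hv0
    have hl0 : 0 ≤ l + C⁻¹ := by
      have h1 := hpos v
      rw [hMv] at h1
      have e : ∑ x, v x * ((l + C⁻¹) • v) x = (l + C⁻¹) * ∑ x, v x ^ 2 := by
        rw [Finset.mul_sum]
        exact Finset.sum_congr rfl fun x _ => by simp only [Pi.smul_apply, smul_eq_mul]; ring
      rw [e] at h1
      have h2 : 0 < ∑ x, v x ^ 2 := by
        obtain ⟨x, hx⟩ := Function.ne_iff.1 hv0
        exact Finset.sum_pos' (fun x _ => sq_nonneg _)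
          ⟨x, Finset.mem_univ x, by have : v x ≠ 0 := hx; positivity⟩
      exact nonneg_of_mul_nonneg_left h1 h2
    have h3 : ‖v‖ ≤ C * ((l + C⁻¹) * ‖v‖) := by
      refine (pi_norm_le_iff_of_nonneg (by positivity)).2 fun x => ?_
      refine hsup v _ (fun y => ?_) x
      rw [hMv, Pi.smul_apply, smul_eq_mul, abs_mul, abs_of_nonneg hl0]
      exact mul_le_mul_of_nonneg_left (norm_le_pi_norm v y) hl0
    have h4 : C * ((l + C⁻¹) * ‖v‖) = ‖v‖ + C * l * ‖v‖ := by field_simp; ring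
    rw [h4] at h3
    have h5 : 0 ≤ C * l * ‖v‖ := by linarith
    have h6 := nonneg_of_mul_nonneg_left h5 hnorm
    exact nonneg_of_mul_nonneg_right h6 hC
  have h := hP.dotProduct_mulVec_nonneg w
  rw [Matrix.sub_mulVec, Matrix.smul_mulVec, Matrix.one_mulVec] at h
  have e : dotProduct (star w) (M.mulVec w - C⁻¹ • w) =
      ∑ x, w x * M.mulVec w x - C⁻¹ * ∑ x, w x ^ 2 := by
    simp only [dotProduct, Pi.star_apply, star_trivial, Pi.sub_apply, Pi.smul_apply, smul_eq_mul,
      Finset.mul_sum, ← Finset.sum_sub_distrib]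
    exact Finset.sum_congr rfl fun x _ => by ring
  rw [e] at h
  linarith

/-- The Combes-Thomas bound in `ℓ²`: conjugating a symmetric matrix with gap `γ` by a weight `Ψ`
changes the symmetric part by the factors `(Ψ z / Ψ x + Ψ x / Ψ z) / 2 - 1`, which are of second
order in the logarithm of the weight. -/
theorem weighted_l2_bound {ι : Type*} [Fintype ι] (M : Matrix ι ι ℝ)
    (hsymm : ∀ x z, M x z = M z x) {γ : ℝ} (hγ : 0 < γ)
    (hgap : ∀ w : ι → ℝ, γ * ∑ x, w x ^ 2 ≤ ∑ x, w x * M.mulVec w x)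
    (Ψ : ι → ℝ) (hΨ : ∀ x, 0 < Ψ x)
    (hpert : ∀ x, ∑ z, |M x z| * ((Ψ z / Ψ x + Ψ x / Ψ z) / 2 - 1) ≤ γ / 2) (u : ι → ℝ) :
    ∑ x, (u x / Ψ x) ^ 2 ≤ 4 / γ ^ 2 * ∑ x, (M.mulVec u x / Ψ x) ^ 2 := by
  set w : ι → ℝ := fun x => u x / Ψ x with hw
  set e : ι → ι → ℝ := fun x z => (Ψ z / Ψ x + Ψ x / Ψ z) / 2 - 1 with he
  have he0 : ∀ x z, 0 ≤ e x z := fun x z => by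
    have h1 := hΨ x
    have h2 := hΨ z
    have e1 : e x z = (Ψ z - Ψ x) ^ 2 / (2 * Ψ x * Ψ z) := by
      simp only [he]
      field_simp
      ring
    rw [e1]
    positivity
  have hsym_e : ∀ x z, e x z = e z x := fun x z => by simp only [he]; ring
  set W : ℝ := ∑ x, w x ^ 2 with hW
  set F : ℝ := ∑ x, (M.mulVec u x / Ψ x) ^ 2 with hF
  set S : ℝ := ∑ x, w x * (M.mulVec u x / Ψ x) with hS
  have hS1 : S = ∑ x, ∑ z, M x z * (w x * w z) * (Ψ z / Ψ x) := by
    simp only [hS, Matrix.mulVec, dotProduct, Finset.sum_div, Finset.mul_sum]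
    refine Finset.sum_congr rfl fun x _ => Finset.sum_congr rfl fun z _ => ?_
    have h1 := (hΨ x).ne'
    have h2 := (hΨ z).ne'
    simp only [hw]
    field_simp
  have hS2 : S = ∑ x, ∑ z, M x z * (w x * w z) * (Ψ x / Ψ z) := by
    rw [hS1, Finset.sum_comm]
    exact Finset.sum_congr rfl fun x _ => Finset.sum_congr rfl fun z _ => by
      rw [hsymm]
      ring
  have hS3 : S = ∑ x, w x * M.mulVec w x + ∑ x, ∑ z, M x z * (w x * w z) * e x z := by
    have : 2 * S = 2 * (∑ x, w x * M.mulVec w x + ∑ x, ∑ z, M x z * (w x * w z) * e x z) := by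
      rw [two_mul S]
      nth_rewrite 1 [hS1]
      rw [hS2]
      simp only [Matrix.mulVec, dotProduct, Finset.mul_sum, ← Finset.sum_add_distrib]
      exact Finset.sum_congr rfl fun x _ => Finset.sum_congr rfl fun z _ => by
        simp only [he]
        ring
    linarith
  have hS4 : -(γ / 2 * W) ≤ ∑ x, ∑ z, M x z * (w x * w z) * e x z := by
    have h1 : ∀ x z, -(|M x z| * e x z * (w x ^ 2 / 2) + |M x z| * e x z * (w z ^ 2 / 2)) ≤
        M x z * (w x * w z) * e x z := fun x z => by
      have h2 : |M x z * (w x * w z)| ≤ |M x z| * (w x ^ 2 / 2 + w z ^ 2 / 2) := by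
        rw [abs_mul]
        refine mul_le_mul_of_nonneg_left ?_ (abs_nonneg _)
        rw [abs_le]
        constructor <;> nlinarith [sq_nonneg (w x - w z), sq_nonneg (w x + w z)]
      have h3 := mul_le_mul_of_nonneg_right (neg_le_of_abs_le h2) (he0 x z)
      linarith
    have h4 : ∑ x, ∑ z, |M x z| * e x z * (w z ^ 2 / 2) =
        ∑ x, ∑ z, |M x z| * e x z * (w x ^ 2 / 2) := by
      rw [Finset.sum_comm]
      exact Finset.sum_congr rfl fun x _ => Finset.sum_congr rfl fun z _ => by
        rw [hsymm, hsym_e]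
    have h5 : ∑ x, ∑ z, |M x z| * e x z * (w x ^ 2 / 2) ≤ γ / 2 * W / 2 := by
      have : γ / 2 * W / 2 = ∑ x, γ / 2 * (w x ^ 2 / 2) := by
        simp only [hW, Finset.mul_sum, Finset.sum_div]
        exact Finset.sum_congr rfl fun x _ => by ring
      rw [this]
      refine Finset.sum_le_sum fun x _ => ?_
      rw [← Finset.sum_mul]
      exact mul_le_mul_of_nonneg_right (hpert x) (by positivity)
    calc -(γ / 2 * W) ≤ ∑ x, ∑ z,
          -(|M x z| * e x z * (w x ^ 2 / 2) + |M x z| * e x z * (w z ^ 2 / 2)) := by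
          simp only [Finset.sum_neg_distrib, Finset.sum_add_distrib, h4]
          linarith
      _ ≤ _ := Finset.sum_le_sum fun x _ => Finset.sum_le_sum fun z _ => h1 x z
  have hS5 : S ≤ γ / 4 * W + 1 / γ * F := by
    simp only [hS, hW, hF, Finset.mul_sum, ← Finset.sum_add_distrib]
    refine Finset.sum_le_sum fun x _ => ?_
    set f := M.mulVec u x / Ψ x
    have h1 : γ / 4 * w x ^ 2 + 1 / γ * f ^ 2 - w x * f = (γ / 2 * w x - f) ^ 2 / γ := by
      field_simp
      ring
    have h2 : 0 ≤ (γ / 2 * w x - f) ^ 2 / γ := by positivity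
    linarith
  have h6 := hgap w
  have h7 : γ / 4 * W ≤ 1 / γ * F := by linarith
  calc W = 4 / γ * (γ / 4 * W) := by field_simp
    _ ≤ 4 / γ * (1 / γ * F) := by gcongr
    _ = _ := by
      field_simp

/-! ### A priori bound for arbitrary coupling -/

/-- The `ℓ¹` distance of two labels. -/
def l1Dist (y x : Cube d n) : ℝ := ∑ i, |((x i : ℕ) : ℝ) - ((y i : ℕ) : ℝ)|

theorem cosh_sub_one_le {t : ℝ} (ht : |t| ≤ 1) : Real.cosh t - 1 ≤ t ^ 2 := by
  have ht2 : t ^ 2 ≤ 1 := (sq_le_one_iff_abs_le_one t).2 ht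
  have h1 := Real.cosh_le_exp_half_sq t
  have h2 := Real.abs_exp_sub_one_le (x := t ^ 2 / 2) (by
    rw [abs_of_nonneg (by positivity)]
    linarith)
  rw [abs_of_nonneg (by positivity : 0 ≤ t ^ 2 / 2)] at h2
  linarith [le_abs_self (Real.exp (t ^ 2 / 2) - 1)]

theorem exp_ratio_sub_one_le {a b B : ℝ} (h : |b - a| ≤ B) (hB : B ≤ 1) :
    (Real.exp b / Real.exp a + Real.exp a / Real.exp b) / 2 - 1 ≤ B ^ 2 := by
  rw [← Real.exp_sub, ← Real.exp_sub, ← neg_sub b a, ← Real.cosh_eq]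
  refine (cosh_sub_one_le (h.trans hB)).trans ?_
  exact sq_le_sq' (neg_le_of_abs_le h) (le_of_abs_le h)

theorem abs_l1Dist_nbr_sub_le (y x : Cube d n) (i : Fin d) (b : Bool) :
    |l1Dist y (nbr i b x) - l1Dist y x| ≤ 1 := by
  have h := sum_update_sub (fun j p => |((p : ℕ) : ℝ) - ((y j : ℕ) : ℝ)|) x i
    (if b then next (x i) else prev (x i))
  rw [l1Dist, l1Dist, nbr, h]
  refine (abs_abs_sub_abs_le _ _).trans ?_
  rw [sub_sub_sub_cancel_right]
  exact abs_next_or_prev_sub_le _ _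

theorem abs_l1Dist_sub_le_of_mem_box {N : ℕ} (hN : 0 < N) (y : Cube d n) {x z : Cube d n}
    (hz : z ∈ box (boxLabel N x)) : |l1Dist y z - l1Dist y x| ≤ d * N := by
  rw [l1Dist, l1Dist, ← Finset.sum_sub_distrib]
  calc _ ≤ ∑ i, |(|((z i : ℕ) : ℝ) - ((y i : ℕ) : ℝ)| - |((x i : ℕ) : ℝ) - ((y i : ℕ) : ℝ)|)| :=
        Finset.abs_sum_le_sum_abs _ _
    _ ≤ ∑ _i : Fin d, (N : ℝ) := Finset.sum_le_sum fun i _ => by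
        refine (abs_abs_sub_abs_le _ _).trans ?_
        rw [sub_sub_sub_cancel_right]
        exact dist_le_of_mem_box hN hz i
    _ = d * N := by simp

/-- The perturbation of the operator under conjugation with the exponential of the `ℓ¹` distance. -/
theorem sum_abs_hamMatrix_mul_le {N : ℕ} (hN : 1 ≤ N) {μ a δ : ℝ} (ha : 0 ≤ a) (hδ : 0 ≤ δ)
    (hδ1 : δ ≤ 1) (hδd : δ * d ≤ 1) (y x : Cube d n) :
    ∑ z, |hamMatrix N μ a x z| *
      ((Real.exp (δ / N * l1Dist y z) / Real.exp (δ / N * l1Dist y x) +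
        Real.exp (δ / N * l1Dist y x) / Real.exp (δ / N * l1Dist y z)) / 2 - 1) ≤
      (2 * d + a * d ^ 2) * δ ^ 2 := by
  have hN' : (1 : ℝ) ≤ N := by exact_mod_cast hN
  set e : Cube d n → ℝ := fun z =>
    (Real.exp (δ / N * l1Dist y z) / Real.exp (δ / N * l1Dist y x) +
        Real.exp (δ / N * l1Dist y x) / Real.exp (δ / N * l1Dist y z)) / 2 - 1 with he
  have he0 : ∀ z, 0 ≤ e z := fun z => by
    simp only [he]
    rw [← Real.exp_sub, ← Real.exp_sub, ← neg_sub (δ / N * l1Dist y z), ← Real.cosh_eq]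
    linarith [Real.one_le_cosh (δ / N * l1Dist y z - δ / N * l1Dist y x)]
  have hex : e x = 0 := by
    simp only [he]
    rw [div_self (Real.exp_pos _).ne']
    norm_num
  have h1 : ∀ z, |hamMatrix N μ a x z| * e z ≤ (N : ℝ) ^ 2 * (adjCount x z * e z) +
      a * (((N : ℝ) ^ d)⁻¹ * ((if boxLabel N x = boxLabel N z then 1 else 0) * e z)) := by
    intro z
    rcases eq_or_ne x z with rfl | hxz
    · simp [hex]
    · have h2 := adjCount_nonneg x z
      have h3 : (0 : ℝ) ≤ if boxLabel N x = boxLabel N z then 1 else 0 := by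
        split_ifs <;> norm_num
      have h4 : |hamMatrix N μ a x z| ≤ (N : ℝ) ^ 2 * adjCount x z +
          a * (((N : ℝ) ^ d)⁻¹ * if boxLabel N x = boxLabel N z then 1 else 0) := by
        have h5 : 0 ≤ (N : ℝ) ^ 2 * adjCount x z := by positivity
        have h6 : 0 ≤ a * (((N : ℝ) ^ d)⁻¹ * if boxLabel N x = boxLabel N z then 1 else 0) :=
          mul_nonneg ha (mul_nonneg (by positivity) h3)
        rw [hamMatrix, if_neg hxz, abs_le]
        constructor <;> linarith
      refine (mul_le_mul_of_nonneg_right h4 (he0 z)).trans (le_of_eq ?_)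
      ring
  refine (Finset.sum_le_sum fun z _ => h1 z).trans ?_
  rw [Finset.sum_add_distrib, ← Finset.mul_sum, ← Finset.mul_sum, ← Finset.mul_sum,
    sum_adjCount_mul, sum_sameBox_mul (by omega)]
  have h7 : ∑ i, ∑ b, e (nbr i b x) ≤ 2 * d * (δ / N) ^ 2 := by
    calc _ ≤ ∑ _i : Fin d, ∑ _b : Bool, (δ / N) ^ 2 :=
          Finset.sum_le_sum fun i _ => Finset.sum_le_sum fun b _ => by
            refine exp_ratio_sub_one_le ?_ ?_
            · rw [← mul_sub, abs_mul, abs_of_nonneg (by positivity)]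
              exact mul_le_of_le_one_right (by positivity) (abs_l1Dist_nbr_sub_le y x i b)
            · rw [div_le_one (by positivity)]
              linarith
      _ = _ := by
          simp only [Finset.sum_const, Finset.card_univ, Fintype.card_fin, Fintype.card_bool,
            nsmul_eq_mul]
          push_cast
          ring
  have h8 : ((N : ℝ) ^ d)⁻¹ * ∑ z ∈ box (boxLabel N x), e z ≤ (δ * d) ^ 2 := by
    calc _ ≤ ((N : ℝ) ^ d)⁻¹ * ∑ z ∈ box (boxLabel N x), (δ * d) ^ 2 := by
          refine mul_le_mul_of_nonneg_left (Finset.sum_le_sum fun z hz => ?_) (by positivity)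
          refine exp_ratio_sub_one_le ?_ hδd
          rw [← mul_sub, abs_mul, abs_of_nonneg (by positivity)]
          calc _ ≤ δ / N * (d * N) := mul_le_mul_of_nonneg_left
                (abs_l1Dist_sub_le_of_mem_box (by omega) y hz) (by positivity)
            _ = δ * d := by field_simp
      _ = fill N x * (δ * d) ^ 2 := by
          simp only [fill, Finset.sum_const, nsmul_eq_mul]
          ring
      _ ≤ (δ * d) ^ 2 := mul_le_of_le_one_left (by positivity) (fill_le_one (by omega) x)
  calc _ ≤ (N : ℝ) ^ 2 * (2 * d * (δ / N) ^ 2) + a * (δ * d) ^ 2 := by gcongr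
    _ = _ := by
      field_simp

theorem sum_pow_dist_le {r : ℝ} (h0 : 0 ≤ r) (h1 : r < 1) (y : Fin n) :
    ∑ j : Fin n, r ^ (((j : ℕ) : ℤ) - ((y : ℕ) : ℤ)).natAbs ≤ 2 / (1 - r) := by
  have hy := y.isLt
  rw [← Finset.sum_range (fun j : ℕ => r ^ ((j : ℤ) - ((y : ℕ) : ℤ)).natAbs)]
  rw [← Finset.sum_fiberwise_of_maps_to (t := Finset.range n)
    (g := fun j : ℕ => ((j : ℤ) - ((y : ℕ) : ℤ)).natAbs) (fun j hj => by
      have := Finset.mem_range.1 hj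
      rw [Finset.mem_range]
      omega)]
  calc _ ≤ ∑ g ∈ Finset.range n, 2 * r ^ g := Finset.sum_le_sum fun g _ => by
        rw [Finset.sum_congr rfl (g := fun _ => r ^ g) fun j hj => by
          rw [(Finset.mem_filter.1 hj).2], Finset.sum_const, nsmul_eq_mul]
        refine mul_le_mul_of_nonneg_right ?_ (pow_nonneg h0 g)
        have hsub : (Finset.range n).filter (fun j : ℕ => ((j : ℤ) - ((y : ℕ) : ℤ)).natAbs = g) ⊆
            {(y : ℕ) + g, (y : ℕ) - g} := fun j hj => by
          have := (Finset.mem_filter.1 hj).2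
          simp only [Finset.mem_insert, Finset.mem_singleton]
          omega
        exact_mod_cast (Finset.card_le_card hsub).trans Finset.card_le_two
    _ = 2 * ∑ g ∈ Finset.range n, r ^ g := by rw [Finset.mul_sum]
    _ ≤ 2 * (1 - r)⁻¹ := by
        have := (summable_geometric_of_lt_one h0 h1).sum_le_tsum (Finset.range n)
          (fun g _ => pow_nonneg h0 g)
        rw [tsum_geometric_of_lt_one h0 h1] at this
        linarith
    _ = 2 / (1 - r) := by rw [div_eq_mul_inv]

/-- The lattice sum of the squared exponential weight, with the volume element `N^{-d}`, is bounded
uniformly in the spacing and the size of the cube. -/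
theorem sum_exp_l1Dist_le {N : ℕ} (hN : 1 ≤ N) {δ : ℝ} (hδ : 0 < δ) (y : Cube d n) :
    ((N : ℝ) ^ d)⁻¹ * ∑ x, (1 / Real.exp (δ / N * l1Dist y x)) ^ 2 ≤ ((1 + 2 * δ) / δ) ^ d := by
  have hN' : (1 : ℝ) ≤ N := by exact_mod_cast hN
  set t : ℝ := 2 * δ / N with ht
  have ht0 : 0 < t := by positivity
  set r : ℝ := Real.exp (-t) with hr
  have hr0 : 0 < r := Real.exp_pos _
  have hr1 : r ≤ 1 / (1 + t) := by
    rw [hr, Real.exp_neg, ← one_div]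
    exact one_div_le_one_div_of_le (by positivity) (by linarith [Real.add_one_le_exp t])
  have hr2 : t / (1 + t) ≤ 1 - r := by
    have : t / (1 + t) = 1 - 1 / (1 + t) := by field_simp; ring
    linarith
  have hr3 : r < 1 := by
    have : 0 < t / (1 + t) := by positivity
    linarith
  have e : ∀ x : Cube d n, (1 / Real.exp (δ / N * l1Dist y x)) ^ 2 =
      ∏ i, r ^ (((x i : ℕ) : ℤ) - ((y i : ℕ) : ℤ)).natAbs := fun x => by
    have e1 : ∀ i, r ^ (((x i : ℕ) : ℤ) - ((y i : ℕ) : ℤ)).natAbs =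
        Real.exp (-t * |((x i : ℕ) : ℝ) - ((y i : ℕ) : ℝ)|) := fun i => by
      rw [hr, ← Real.exp_nat_mul, Nat.cast_natAbs, mul_comm]
      push_cast
      ring_nf
    simp only [e1]
    rw [← Real.exp_sum, one_div, ← Real.exp_neg, ← Real.exp_nat_mul, ← Finset.mul_sum, l1Dist, ht]
    congr 1
    push_cast
    ring
  have h1 : ∑ x : Cube d n, ∏ i, r ^ (((x i : ℕ) : ℤ) - ((y i : ℕ) : ℤ)).natAbs =
      ∏ i : Fin d, ∑ j : Fin n, r ^ (((j : ℕ) : ℤ) - ((y i : ℕ) : ℤ)).natAbs := by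
    rw [Finset.prod_univ_sum, Fintype.piFinset_univ]
  simp only [e]
  rw [h1]
  have h2 : ∀ i : Fin d, ∑ j : Fin n, r ^ (((j : ℕ) : ℤ) - ((y i : ℕ) : ℤ)).natAbs ≤
      N * ((1 + 2 * δ) / δ) := fun i => by
    refine (sum_pow_dist_le hr0.le hr3 (y i)).trans ?_
    calc 2 / (1 - r) ≤ 2 / (t / (1 + t)) := by gcongr
      _ = N * ((1 + t) / δ) := by
          rw [ht]
          field_simp
      _ ≤ N * ((1 + 2 * δ) / δ) := by
          gcongr
          exact div_le_self (by positivity) hN'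
  calc _ ≤ ((N : ℝ) ^ d)⁻¹ * ∏ _i : Fin d, N * ((1 + 2 * δ) / δ) := by
        refine mul_le_mul_of_nonneg_left ?_ (by positivity)
        exact Finset.prod_le_prod
          (fun i _ => Finset.sum_nonneg fun j _ => pow_nonneg hr0.le _) fun i _ => h2 i
    _ = _ := by
        rw [Finset.prod_const, Finset.card_univ, Fintype.card_fin, mul_pow]
        field_simp

theorem sq_blockAvg_le {N : ℕ} (hN : 1 ≤ N) (u : Cube d n → ℝ) (x : Cube d n) :
    blockAvg N u x ^ 2 ≤ ((N : ℝ) ^ d)⁻¹ * ∑ z ∈ box (boxLabel N x), u z ^ 2 := by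
  have hN' : (1 : ℝ) ≤ N := by exact_mod_cast hN
  have h1 := sq_sum_le_card_mul_sum_sq (s := box (boxLabel N x)) (f := u)
  have h2 := fill_le_one (by omega : 0 < N) x
  have h3 : 0 ≤ ((N : ℝ) ^ d)⁻¹ * ∑ z ∈ box (boxLabel N x), u z ^ 2 :=
    mul_nonneg (by positivity) (Finset.sum_nonneg fun z _ => sq_nonneg _)
  calc blockAvg N u x ^ 2 = (((N : ℝ) ^ d)⁻¹) ^ 2 * (∑ z ∈ box (boxLabel N x), u z) ^ 2 := by
        rw [blockAvg, mul_pow]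
    _ ≤ (((N : ℝ) ^ d)⁻¹) ^ 2 *
        ((box (boxLabel N x)).card * ∑ z ∈ box (boxLabel N x), u z ^ 2) := by gcongr
    _ = fill N x * (((N : ℝ) ^ d)⁻¹ * ∑ z ∈ box (boxLabel N x), u z ^ 2) := by rw [fill]; ring
    _ ≤ _ := mul_le_of_le_one_left h3 h2

/-- The a priori bound for a small coupling `s` extends to all larger couplings: it gives a gap in
`ℓ²`, which is monotone in the coupling; by the weighted `ℓ²` bound the box averages of `u` are
controlled, and `(a - s) Q^* Q u` can be moved to the right-hand side. -/
theorem AprioriBound.mono_coupling {s C a : ℝ} (hs : 0 < s) (hC : 0 < C)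
    (h : AprioriBound d s C) (ha : 0 < a) :
    ∃ C', 0 < C' ∧ ∀ a', s ≤ a' → a' ≤ a → AprioriBound d a' C' := by
  set γ : ℝ := C⁻¹ with hγ
  have hγ0 : 0 < γ := by positivity
  obtain ⟨δ, hδ0, hδ1, hδd, hδγ⟩ : ∃ δ : ℝ, 0 < δ ∧ δ ≤ 1 ∧ δ * d ≤ 1 ∧
      (2 * d + a * d ^ 2) * δ ^ 2 ≤ γ / 2 := by
    set P : ℝ := 1 + 2 * d + a * d ^ 2 + 2 / γ with hP
    have hP0 : 0 < P := by positivity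
    have h1 : (0 : ℝ) ≤ 2 * d := by positivity
    have h2 : 0 ≤ a * (d : ℝ) ^ 2 := by positivity
    have h3 : 0 < 2 / γ := by positivity
    have h4 : 1 / P ≤ 1 := by rw [div_le_one hP0]; linarith
    refine ⟨1 / P, by positivity, h4, ?_, ?_⟩
    · rw [one_div_mul_eq_div, div_le_one hP0]
      have : (0 : ℝ) ≤ d := by positivity
      linarith
    · have h5 : (2 * d + a * d ^ 2) * (1 / P) ≤ 1 := by
        rw [mul_one_div, div_le_one hP0]
        linarith
      have h6 : 1 / P ≤ γ / 2 := by
        rw [div_le_div_iff₀ hP0 (by norm_num)]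
        have : γ * (2 / γ) = 2 := by field_simp
        nlinarith
      calc _ = (2 * d + a * d ^ 2) * (1 / P) * (1 / P) := by ring
        _ ≤ 1 * (γ / 2) := by gcongr
        _ = γ / 2 := one_mul _
  set K : ℝ := √(Real.exp (δ * d) ^ 2 * (4 / γ ^ 2 * ((1 + 2 * δ) / δ) ^ d)) with hK
  have hK0 : 0 ≤ K := Real.sqrt_nonneg _
  refine ⟨C * (1 + a * K), by positivity, fun a' hsa haa => ?_⟩
  intro N q n hN hq hn μ hμ u A hA
  have hN1 : 1 ≤ N := by omega
  have hN0 : 0 < N := by omega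
  have hNr : (0 : ℝ) < N := by exact_mod_cast hN0
  have hgap : ∀ w : Cube d n → ℝ,
      γ * ∑ x, w x ^ 2 ≤ ∑ x, w x * (hamMatrix N μ a').mulVec w x := by
    intro w
    have h1 := gap_of_sup_bound (hamMatrix (d := d) (n := n) N μ s) (hamMatrix_comm N μ s)
      (fun w => by
        simp only [hamMatrix_mulVec hN0]
        exact sum_mul_ham_nonneg hN0 hμ hs.le w) hC
      (fun v B hB x => (h N q n hN hq hn μ hμ v B (fun y => by
        rw [← hamMatrix_mulVec hN0]
        exact hB y) x).1) w
    simp only [hamMatrix_mulVec hN0] at h1 ⊢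
    exact h1.trans (sum_mul_ham_mono hN0 hsa w)
  have hblock : ∀ y, |blockAvg N u y| ≤ K * A := by
    intro y
    have hA0 : 0 ≤ A := (abs_nonneg _).trans (hA y)
    have h2 := weighted_l2_bound (hamMatrix N μ a') (hamMatrix_comm N μ a') hγ0 hgap
      (fun x => Real.exp (δ / N * l1Dist y x)) (fun x => Real.exp_pos _)
      (fun x => by
        refine (sum_abs_hamMatrix_mul_le hN1 (hs.le.trans hsa) hδ0.le hδ1 hδd y x).trans
          (le_trans ?_ hδγ)
        gcongr) u
    simp only [hamMatrix_mulVec hN0] at h2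
    have h3 : ∑ z ∈ box (boxLabel N y), u z ^ 2 ≤
        Real.exp (δ * d) ^ 2 * ∑ x, (u x / Real.exp (δ / N * l1Dist y x)) ^ 2 := by
      rw [Finset.mul_sum]
      calc _ ≤ ∑ z ∈ box (boxLabel N y),
            Real.exp (δ * d) ^ 2 * (u z / Real.exp (δ / N * l1Dist y z)) ^ 2 := by
            refine Finset.sum_le_sum fun z hz => ?_
            have h4 : δ / N * l1Dist y z ≤ δ * d := by
              have h5 := abs_l1Dist_sub_le_of_mem_box hN0 y hz
              have h6 : l1Dist y y = 0 := by simp [l1Dist]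
              rw [h6, sub_zero] at h5
              calc _ ≤ δ / N * (d * N) := by
                    gcongr
                    exact le_of_abs_le h5
                _ = δ * d := by field_simp
            rw [div_pow, mul_div_assoc', le_div_iff₀ (by positivity), mul_comm]
            gcongr
        _ ≤ _ := Finset.sum_le_sum_of_subset_of_nonneg (Finset.subset_univ _)
            fun x _ _ => by positivity
    have h7 : ∑ x, (ham N μ a' u x / Real.exp (δ / N * l1Dist y x)) ^ 2 ≤
        A ^ 2 * ∑ x, (1 / Real.exp (δ / N * l1Dist y x)) ^ 2 := by
      rw [Finset.mul_sum]
      refine Finset.sum_le_sum fun x _ => ?_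
      rw [← mul_pow, mul_one_div, div_pow, div_pow]
      have : ham N μ a' u x ^ 2 ≤ A ^ 2 := sq_le_sq' (neg_le_of_abs_le (hA x)) (le_of_abs_le (hA x))
      gcongr
    have h8 := sum_exp_l1Dist_le hN1 hδ0 y
    have h9 : blockAvg N u y ^ 2 ≤ (K * A) ^ 2 := by
      rw [mul_pow, hK, Real.sq_sqrt (by positivity)]
      calc blockAvg N u y ^ 2 ≤ _ := sq_blockAvg_le hN1 u y
        _ ≤ ((N : ℝ) ^ d)⁻¹ * (Real.exp (δ * d) ^ 2 * (4 / γ ^ 2 *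
            (A ^ 2 * ∑ x, (1 / Real.exp (δ / N * l1Dist y x)) ^ 2))) := by
            gcongr
            refine h3.trans ?_
            gcongr
            refine h2.trans ?_
            gcongr
        _ = Real.exp (δ * d) ^ 2 * (4 / γ ^ 2 * (((N : ℝ) ^ d)⁻¹ *
            ∑ x, (1 / Real.exp (δ / N * l1Dist y x)) ^ 2)) * A ^ 2 := by ring
        _ ≤ _ := by gcongr
    exact abs_le_of_sq_le_sq h9 (by positivity)
  have hsmall : ∀ x, |ham N μ s u x| ≤ (1 + a * K) * A := fun x => by
    have hA0 : 0 ≤ A := (abs_nonneg _).trans (hA x)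
    have e : ham N μ s u x = ham N μ a' u x - (a' - s) * blockAvg N u x := by
      simp only [ham]
      ring
    rw [e]
    refine (abs_sub _ _).trans ?_
    rw [abs_mul, abs_of_nonneg (sub_nonneg.2 hsa)]
    calc _ ≤ A + a * (K * A) := by
          gcongr
          · exact hA x
          · linarith
          · exact hblock x
      _ = _ := by ring
  intro x
  obtain ⟨h1, h2⟩ := h N q n hN hq hn μ hμ u _ hsmall x
  refine ⟨h1.trans (le_of_eq (by ring)), fun i b => (h2 i b).trans (le_of_eq (by ring))⟩

/-! ### Exponential weights compatible with the Neumann condition -/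

/-- The slope, on the edge from `t` to `t + 1`, of the exponent of the weight: it is `1` away from
the ends of the segment `{0, …, n - 1}` and decreases linearly to `0` at the ends. -/
def slope (n N t : ℕ) : ℝ := min 1 (min (((t + 1 : ℕ) : ℝ) / N) (((n - 1 - t : ℕ) : ℝ) / N))

/-- A substitute for the coordinate `j` that is flat at both ends of `{0, …, n - 1}`, so that its
exponentials almost satisfy the Neumann condition. -/
def flatCoord (n N j : ℕ) : ℝ := ∑ t ∈ Finset.range j, slope n N t

theorem slope_nonneg (n N t : ℕ) : 0 ≤ slope n N t :=
  le_min zero_le_one (le_min (by positivity) (by positivity))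

theorem slope_le_one (n N t : ℕ) : slope n N t ≤ 1 := min_le_left _ _

theorem abs_min_sub_min_le {a b a' b' B : ℝ} (h1 : |a - a'| ≤ B) (h2 : |b - b'| ≤ B) :
    |min a b - min a' b'| ≤ B :=
  (abs_min_sub_min_le_max a b a' b').trans (max_le h1 h2)

theorem abs_slope_succ_sub_le {N : ℕ} (hN : 1 ≤ N) (n t : ℕ) :
    |slope n N (t + 1) - slope n N t| ≤ 1 / N := by
  have hN' : (0 : ℝ) < N := by exact_mod_cast hN
  refine abs_min_sub_min_le (by rw [sub_self, abs_zero]; positivity) (abs_min_sub_min_le ?_ ?_)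
  · rw [← sub_div, abs_div, abs_of_pos hN']
    push_cast
    gcongr
    norm_num
  · rw [← sub_div, abs_div, abs_of_pos hN']
    gcongr
    have h1 : n - 1 - (t + 1) ≤ n - 1 - t := by omega
    have h2 : n - 1 - t ≤ n - 1 - (t + 1) + 1 := by omega
    have h1' : ((n - 1 - (t + 1) : ℕ) : ℝ) ≤ ((n - 1 - t : ℕ) : ℝ) := by exact_mod_cast h1
    have h2' : ((n - 1 - t : ℕ) : ℝ) ≤ ((n - 1 - (t + 1) : ℕ) : ℝ) + 1 := by exact_mod_cast h2
    rw [abs_le]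
    constructor <;> linarith

theorem flatCoord_next_sub (N : ℕ) (p : Fin n) :
    flatCoord n N (next p) - flatCoord n N p = slope n N p := by
  have hp := p.isLt
  rcases Nat.lt_or_ge ((p : ℕ) + 1) n with h | h
  · have : (next p : ℕ) = p + 1 := by simp only [next]; omega
    rw [this, flatCoord, Finset.sum_range_succ, flatCoord]
    ring
  · have h1 : (next p : ℕ) = p := by simp only [next]; omega
    have h2 : n - 1 - (p : ℕ) = 0 := by omega
    have h3 : (0 : ℝ) ≤ ((((p : ℕ) + 1 : ℕ) : ℝ)) / N := by positivity
    rw [h1, sub_self, slope, h2, Nat.cast_zero, zero_div, min_eq_right h3,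
      min_eq_right zero_le_one]

/-- The increments of `flatCoord` towards the two neighbours cancel to first order, also at the
ends of the segment. -/
theorem flatCoord_prev_sub {N : ℕ} (hN : 1 ≤ N) (p : Fin n) :
    |flatCoord n N (prev p) - flatCoord n N p| ≤ 1 ∧
      |slope n N p + (flatCoord n N (prev p) - flatCoord n N p)| ≤ 1 / N := by
  have hN' : (0 : ℝ) < N := by exact_mod_cast hN
  rcases Nat.eq_zero_or_pos (p : ℕ) with h | h
  · have : (prev p : ℕ) = p := by simp only [prev]; omega
    rw [this, sub_self, add_zero, abs_zero, abs_of_nonneg (slope_nonneg _ _ _)]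
    refine ⟨zero_le_one, (min_le_right _ _).trans ((min_le_left _ _).trans ?_)⟩
    rw [h]
    norm_num
  · obtain ⟨t, ht⟩ := Nat.exists_eq_add_of_le' h
    have : (prev p : ℕ) = t := by simp only [prev]; omega
    have e : flatCoord n N (prev p) - flatCoord n N p = -slope n N t := by
      rw [this, ht, flatCoord, flatCoord, Finset.sum_range_succ]
      ring
    rw [e, abs_neg, abs_of_nonneg (slope_nonneg _ _ _), ht, ← sub_eq_add_neg]
    exact ⟨slope_le_one _ _ _, abs_slope_succ_sub_le hN n t⟩

theorem flatCoord_sub_le (N : ℕ) {i j : ℕ} (h : i ≤ j) :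
    |flatCoord n N j - flatCoord n N i| ≤ (j : ℝ) - i := by
  rw [flatCoord, flatCoord, ← Finset.sum_Ico_eq_sub _ h,
    abs_of_nonneg (Finset.sum_nonneg fun t _ => slope_nonneg _ _ _)]
  calc _ ≤ ∑ _t ∈ Finset.Ico i j, (1 : ℝ) := Finset.sum_le_sum fun t _ => slope_le_one _ _ _
    _ = _ := by simp [Nat.cast_sub h]

theorem abs_flatCoord_sub_le (N i j : ℕ) :
    |flatCoord n N j - flatCoord n N i| ≤ |(j : ℝ) - i| := by
  rcases le_total i j with h | h
  · exact (flatCoord_sub_le N h).trans (le_abs_self _)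
  · rw [abs_sub_comm, abs_sub_comm (j : ℝ)]
    exact (flatCoord_sub_le N h).trans (le_abs_self _)

/-- The flattening at the ends changes differences of coordinates by at most two units of length. -/
theorem sub_le_flatCoord_sub {N : ℕ} (hN : 1 ≤ N) {i j : ℕ} (h : i ≤ j) (hj : j < n) :
    (j : ℝ) - i - 2 * N ≤ flatCoord n N j - flatCoord n N i := by
  have hN' : (0 : ℝ) < N := by exact_mod_cast hN
  -- the slope differs from `1` only for `t < N` and for `n - N ≤ t`
  have hmono : Monotone fun t : ℕ =>
      flatCoord n N t - (t - ((min t N : ℕ) : ℝ) - ((max t (n - N) : ℕ) : ℝ)) := by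
    refine monotone_nat_of_le_succ fun t => ?_
    have e : flatCoord n N (t + 1) = flatCoord n N t + slope n N t := Finset.sum_range_succ _ _
    simp only [e]
    have h0 := slope_nonneg n N t
    rcases Nat.lt_or_ge t N with h1 | h1
    · have h2 : min (t + 1) N = min t N + 1 := by omega
      have h3 : max t (n - N) ≤ max (t + 1) (n - N) := by omega
      have h3' : ((max t (n - N) : ℕ) : ℝ) ≤ ((max (t + 1) (n - N) : ℕ) : ℝ) := by exact_mod_cast h3
      rw [h2]
      push_cast at h3' ⊢
      linarith
    · have h2 : min (t + 1) N = min t N := by omega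
      rcases Nat.lt_or_ge t (n - N) with h4 | h4
      · have h5 : max (t + 1) (n - N) = max t (n - N) := by omega
        have h6 : slope n N t = 1 := by
          refine min_eq_left (le_min ?_ ?_)
          · rw [one_le_div hN']
            exact_mod_cast (by omega : N ≤ t + 1)
          · rw [one_le_div hN']
            exact_mod_cast (by omega : N ≤ n - 1 - t)
        rw [h2, h5, h6]
        push_cast
        linarith
      · have h5 : max (t + 1) (n - N) = max t (n - N) + 1 := by omega
        rw [h2, h5]
        push_cast
        linarith
  have h1 := hmono h
  simp only at h1
  have h2 : min j N + max j (n - N) ≤ min i N + max i (n - N) + 2 * N := by omega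
  have h2' : ((min j N : ℕ) : ℝ) + ((max j (n - N) : ℕ) : ℝ) ≤
      ((min i N : ℕ) : ℝ) + ((max i (n - N) : ℕ) : ℝ) + 2 * N := by exact_mod_cast h2
  linarith

/-- The one-dimensional weights of which the weight of the cube is a sum. -/
def expFlat (n N : ℕ) (κ c : ℝ) (p : Fin n) : ℝ := Real.exp (κ * (flatCoord n N p - c))

theorem expFlat_pos (N : ℕ) (κ c : ℝ) (p : Fin n) : 0 < expFlat n N κ c p := Real.exp_pos _

theorem abs_expFlat_sub_le {N : ℕ} {κ c B : ℝ} {p p' : Fin n} (hB : B ≤ 1)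
    (h : |κ| * |((p' : ℕ) : ℝ) - ((p : ℕ) : ℝ)| ≤ B) :
    |expFlat n N κ c p' - expFlat n N κ c p| ≤ 2 * B * expFlat n N κ c p := by
  have h1 : |κ * (flatCoord n N p' - flatCoord n N p)| ≤ B := by
    rw [abs_mul]
    exact (mul_le_mul_of_nonneg_left (abs_flatCoord_sub_le N _ _) (abs_nonneg _)).trans h
  have e : expFlat n N κ c p' - expFlat n N κ c p =
      (Real.exp (κ * (flatCoord n N p' - flatCoord n N p)) - 1) * expFlat n N κ c p := by
    rw [expFlat, expFlat, sub_mul, ← Real.exp_add, one_mul]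
    ring_nf
  rw [e, abs_mul, abs_of_pos (expFlat_pos N κ c p)]
  refine mul_le_mul_of_nonneg_right ?_ (expFlat_pos N κ c p).le
  exact (Real.abs_exp_sub_one_le (h1.trans hB)).trans (by linarith)

theorem abs_expFlat_next_add_prev_le {N : ℕ} (hN : 1 ≤ N) {κ c δ : ℝ} (hδ1 : δ ≤ 1)
    (hκ : |κ| ≤ δ / N) (p : Fin n) :
    |∑ b : Bool, (expFlat n N κ c (if b then next p else prev p) - expFlat n N κ c p)| ≤
      3 * δ / (N : ℝ) ^ 2 * expFlat n N κ c p := by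
  have hN' : (1 : ℝ) ≤ N := by exact_mod_cast hN
  have hδN0 : 0 ≤ δ / N := (abs_nonneg _).trans hκ
  have hδ0 : 0 ≤ δ := by
    have := mul_nonneg hδN0 (by linarith : (0 : ℝ) ≤ N)
    rwa [div_mul_cancel₀ _ (by positivity)] at this
  have hδN1 : δ / N ≤ 1 := by
    rw [div_le_one (by positivity)]
    linarith
  obtain ⟨h1, h2⟩ := flatCoord_prev_sub (n := n) hN p
  set α : ℝ := κ * slope n N p with hα
  set β : ℝ := κ * (flatCoord n N (prev p) - flatCoord n N p) with hβ
  have hα1 : |α| ≤ δ / N := by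
    rw [hα, abs_mul, abs_of_nonneg (slope_nonneg _ _ _)]
    exact (mul_le_of_le_one_right (abs_nonneg _) (slope_le_one _ _ _)).trans hκ
  have hβ1 : |β| ≤ δ / N := by
    rw [hβ, abs_mul]
    exact (mul_le_of_le_one_right (abs_nonneg _) h1).trans hκ
  have hαβ : |α + β| ≤ δ / N * (1 / N) := by
    rw [hα, hβ, ← mul_add, abs_mul]
    exact mul_le_mul hκ h2 (abs_nonneg _) hδN0
  have e : ∑ b : Bool, (expFlat n N κ c (if b then next p else prev p) - expFlat n N κ c p) =
      ((Real.exp α - 1 - α) + (Real.exp β - 1 - β) + (α + β)) * expFlat n N κ c p := by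
    simp only [Fintype.sum_bool, if_true, Bool.false_eq_true, if_false]
    have e1 : expFlat n N κ c (next p) = Real.exp α * expFlat n N κ c p := by
      rw [expFlat, expFlat, ← Real.exp_add, hα, ← flatCoord_next_sub]
      ring_nf
    have e2 : expFlat n N κ c (prev p) = Real.exp β * expFlat n N κ c p := by
      rw [expFlat, expFlat, ← Real.exp_add, hβ]
      ring_nf
    rw [e1, e2]
    ring
  rw [e, abs_mul, abs_of_pos (expFlat_pos N κ c p)]
  refine mul_le_mul_of_nonneg_right ?_ (expFlat_pos N κ c p).le
  have hsq : ∀ t : ℝ, |t| ≤ δ / N → |Real.exp t - 1 - t| ≤ (δ / N) ^ 2 := fun t ht =>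
    (Real.abs_exp_sub_one_sub_id_le (ht.trans hδN1)).trans
      (sq_le_sq' (neg_le_of_abs_le ht) (le_of_abs_le ht))
  have h3 : (δ / N) ^ 2 ≤ δ / N * (1 / N) := by
    rw [sq]
    gcongr
  calc _ ≤ |Real.exp α - 1 - α| + |Real.exp β - 1 - β| + |α + β| :=
        (abs_add_le _ _).trans (add_le_add (abs_add_le _ _) le_rfl)
    _ ≤ (δ / N) ^ 2 + (δ / N) ^ 2 + δ / N * (1 / N) := by
        gcongr
        · exact hsq α hα1
        · exact hsq β hβ1
    _ ≤ 3 * (δ / N * (1 / N)) := by linarith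
    _ = _ := by field_simp

/-- A weight that grows exponentially away from `y`, whose first and second differences at unit
scale, including those at the boundary with the Neumann convention, are small relative to it. -/
theorem exists_weight (hd : 1 ≤ d) {N : ℕ} (hN : 1 ≤ N) {δ : ℝ} (hδ0 : 0 < δ) (hδ1 : δ ≤ 1)
    (y : Cube d n) : ∃ Φ : Cube d n → ℝ, (∀ x, 0 < Φ x) ∧ Φ y = 2 * d ∧
      (∀ x i, Real.exp (δ / N * |((x i : ℕ) : ℝ) - ((y i : ℕ) : ℝ)|) ≤
        Real.exp (2 * δ) * Φ x) ∧
      (∀ x i b, |Φ (nbr i b x) - Φ x| ≤ 2 * δ / N * Φ x) ∧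
      (∀ x i, |∑ b, (Φ (nbr i b x) - Φ x)| ≤ 3 * δ / (N : ℝ) ^ 2 * Φ x) ∧
      ∀ x, ∀ z ∈ box (boxLabel N x), |Φ z - Φ x| ≤ 2 * δ * Φ x := by
  have hN' : (1 : ℝ) ≤ N := by exact_mod_cast hN
  have hκ : |δ / N| ≤ δ / N := (abs_of_nonneg (by positivity)).le
  have hκ' : |-(δ / N)| ≤ δ / N := by rw [abs_neg]; exact hκ
  have hδN1 : δ / N ≤ 1 := by rw [div_le_one (by positivity)]; linarith
  set c : Fin d → ℝ := fun i => flatCoord n N (y i) with hc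
  set g : Fin d → Fin n → ℝ := fun i p =>
    expFlat n N (δ / N) (c i) p + expFlat n N (-(δ / N)) (c i) p with hg
  have hf0 : ∀ κ i p, 0 < expFlat n N κ (c i) p := fun κ i p => expFlat_pos N κ (c i) p
  have hg0 : ∀ i p, 0 < g i p := fun i p => add_pos (hf0 _ _ _) (hf0 _ _ _)
  have hgle : ∀ (x : Cube d n) i, g i (x i) ≤ ∑ j, g j (x j) := fun x i =>
    Finset.single_le_sum (f := fun j => g j (x j)) (fun j _ => (hg0 j _).le) (Finset.mem_univ i)
  refine ⟨fun x => ∑ i, g i (x i), fun x => ?_, ?_, fun x i => ?_, fun x i b => ?_, fun x i => ?_,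
    fun x z hz => ?_⟩
  · exact Finset.sum_pos (fun i _ => hg0 i _) ⟨⟨0, hd⟩, Finset.mem_univ _⟩
  · have : ∀ i, g i (y i) = 2 := fun i => by
      simp only [hg, hc, expFlat, sub_self, mul_zero, Real.exp_zero]
      norm_num
    simp [this, mul_comm]
  · have key : δ / N * |((x i : ℕ) : ℝ) - ((y i : ℕ) : ℝ)| ≤
        2 * δ + δ / N * |flatCoord n N (x i) - c i| := by
      have h1 : |((x i : ℕ) : ℝ) - ((y i : ℕ) : ℝ)| ≤ 2 * N + |flatCoord n N (x i) - c i| := by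
        rcases le_total (y i : ℕ) (x i : ℕ) with h | h
        · have h2 := sub_le_flatCoord_sub hN h (x i).isLt
          have h3 : ((y i : ℕ) : ℝ) ≤ ((x i : ℕ) : ℝ) := by exact_mod_cast h
          rw [abs_of_nonneg (by linarith)]
          linarith [le_abs_self (flatCoord n N (x i) - c i)]
        · have h2 := sub_le_flatCoord_sub hN h (y i).isLt
          have h3 : ((x i : ℕ) : ℝ) ≤ ((y i : ℕ) : ℝ) := by exact_mod_cast h
          rw [abs_sub_comm, abs_of_nonneg (by linarith)]
          linarith [neg_abs_le (flatCoord n N (x i) - c i)]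
      calc _ ≤ δ / N * (2 * N + |flatCoord n N (x i) - c i|) := by gcongr
        _ = _ := by field_simp
    refine (Real.exp_le_exp.2 key).trans ?_
    rw [Real.exp_add]
    refine mul_le_mul_of_nonneg_left (le_trans ?_ (hgle x i)) (Real.exp_pos _).le
    simp only [hg, expFlat]
    have e1 := Real.exp_pos (δ / N * (flatCoord n N (x i) - c i))
    have e2 := Real.exp_pos (-(δ / N) * (flatCoord n N (x i) - c i))
    rcases abs_cases (flatCoord n N (x i) - c i) with ⟨h, -⟩ | ⟨h, -⟩
    · rw [h]
      linarith
    · rw [h, mul_neg, ← neg_mul]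
      linarith
  · rw [nbr, sum_update_sub]
    refine le_trans ?_ (mul_le_mul_of_nonneg_left (hgle x i) (by positivity))
    simp only [hg]
    have hB : ∀ κ, |κ| ≤ δ / N → |κ| *
        |(((if b then next (x i) else prev (x i) : Fin n) : ℕ) : ℝ) - ((x i : ℕ) : ℝ)| ≤ δ / N :=
      fun κ h => (mul_le_of_le_one_right (abs_nonneg _) (abs_next_or_prev_sub_le _ _)).trans h
    have h1 := abs_expFlat_sub_le (N := N) (c := c i) hδN1 (hB _ hκ)
    have h2 := abs_expFlat_sub_le (N := N) (c := c i) hδN1 (hB _ hκ')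
    rw [add_sub_add_comm]
    refine (abs_add_le _ _).trans ((add_le_add h1 h2).trans (le_of_eq ?_))
    ring
  · simp only [nbr, sum_update_sub]
    refine le_trans ?_ (mul_le_mul_of_nonneg_left (hgle x i) (by positivity))
    have h1 := abs_expFlat_next_add_prev_le (c := c i) hN hδ1 hκ (x i)
    have h2 := abs_expFlat_next_add_prev_le (c := c i) hN hδ1 hκ' (x i)
    simp only [hg, add_sub_add_comm, Finset.sum_add_distrib]
    refine (abs_add_le _ _).trans ((add_le_add h1 h2).trans (le_of_eq ?_))
    ring
  · rw [← Finset.sum_sub_distrib, Finset.mul_sum]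
    refine (Finset.abs_sum_le_sum_abs _ _).trans (Finset.sum_le_sum fun i _ => ?_)
    have hB : ∀ κ, |κ| ≤ δ / N → |κ| * |((z i : ℕ) : ℝ) - ((x i : ℕ) : ℝ)| ≤ δ := fun κ h => by
      calc _ ≤ δ / N * N := mul_le_mul h (dist_le_of_mem_box hN hz i) (abs_nonneg _) (by positivity)
        _ = δ := by field_simp
    have h1 := abs_expFlat_sub_le (N := N) (c := c i) hδ1 (hB _ hκ)
    have h2 := abs_expFlat_sub_le (N := N) (c := c i) hδ1 (hB _ hκ')
    simp only [hg, add_sub_add_comm]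
    refine (abs_add_le _ _).trans ((add_le_add h1 h2).trans (le_of_eq ?_))
    ring

/-- The a priori bound in weighted supremum norms. Conjugation with a weight that varies slowly
perturbs the operator by a first-order term with small coefficients, which the gradient part of the
a priori bound absorbs. -/
theorem AprioriBound.weighted {a C δ : ℝ} (ha : 0 ≤ a) (hC : 0 < C)
    (h : AprioriBound d a C) (hδ0 : 0 < δ) (hδ : (7 * d + 2 * a) * C * δ ≤ 1 / 2) {N q : ℕ}
    (hN : 3 ≤ N) (hq : 1 ≤ q) (hn : n = N * q + 1 ∨ n = N * q) {μ : ℝ} (hμ : 0 ≤ μ)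
    (Φ : Cube d n → ℝ) (hΦ : ∀ x, 0 < Φ x)
    (hΦ1 : ∀ x i b, |Φ (nbr i b x) - Φ x| ≤ 2 * δ / N * Φ x)
    (hΦ2 : ∀ x i, |∑ b, (Φ (nbr i b x) - Φ x)| ≤ 3 * δ / (N : ℝ) ^ 2 * Φ x)
    (hΦ3 : ∀ x, ∀ z ∈ box (boxLabel N x), |Φ z - Φ x| ≤ 2 * δ * Φ x)
    (u : Cube d n → ℝ) {B : ℝ} (hB : 0 ≤ B) (hu : ∀ x, |ham N μ a u x| ≤ B * Φ x) (x : Cube d n) :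
    |u x| ≤ 2 * C * B * Φ x := by
  have hN0 : 0 < N := by omega
  have hNr : (0 : ℝ) < N := by exact_mod_cast hN0
  set w : Cube d n → ℝ := fun x => u x / Φ x with hw
  have huw : ∀ x, u x = Φ x * w x := fun x => by
    have := (hΦ x).ne'
    simp only [hw]
    field_simp
  set M : ℝ := ‖fun x => ham N μ a w x‖ with hM
  have hM0 : 0 ≤ M := norm_nonneg _
  have hap := h N q n hN hq hn μ hμ w M (fun x => norm_le_pi_norm (fun x => ham N μ a w x) x)
  have hlap : ∀ x, |lap N u x - Φ x * lap N w x| ≤ 7 * d * C * δ * M * Φ x := fun x => by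
    have e : lap N u x - Φ x * lap N w x = (N : ℝ) ^ 2 * ∑ i,
        (∑ b, (Φ (nbr i b x) - Φ x) * (w (nbr i b x) - w x) +
          w x * ∑ b, (Φ (nbr i b x) - Φ x)) := by
      simp only [lap, huw, Finset.mul_sum, ← Finset.sum_add_distrib, ← Finset.sum_sub_distrib]
      exact Finset.sum_congr rfl fun i _ => Finset.sum_congr rfl fun b _ => by ring
    have h1 : ∀ i, |∑ b, (Φ (nbr i b x) - Φ x) * (w (nbr i b x) - w x) +
        w x * ∑ b, (Φ (nbr i b x) - Φ x)| ≤ 7 * C * δ * M / (N : ℝ) ^ 2 * Φ x := fun i => by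
      have h2 : |∑ b, (Φ (nbr i b x) - Φ x) * (w (nbr i b x) - w x)| ≤
          2 * (2 * δ / N * Φ x * (C / N * M)) := by
        refine (Finset.abs_sum_le_sum_abs _ _).trans ?_
        calc _ ≤ ∑ _b : Bool, 2 * δ / N * Φ x * (C / N * M) :=
              Finset.sum_le_sum fun b _ => by
                rw [abs_mul]
                exact mul_le_mul (hΦ1 x i b) ((hap x).2 i b) (abs_nonneg _)
                  ((abs_nonneg _).trans (hΦ1 x i b))
          _ = _ := by
            simp only [Finset.sum_const, Finset.card_univ, Fintype.card_bool, nsmul_eq_mul]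
            push_cast
            ring
      have h3 : |w x * ∑ b, (Φ (nbr i b x) - Φ x)| ≤ C * M * (3 * δ / (N : ℝ) ^ 2 * Φ x) := by
        rw [abs_mul]
        exact mul_le_mul (hap x).1 (hΦ2 x i) (abs_nonneg _) (by positivity)
      refine (abs_add_le _ _).trans ((add_le_add h2 h3).trans (le_of_eq ?_))
      field_simp
      ring
    rw [e, abs_mul, abs_of_nonneg (by positivity)]
    calc _ ≤ (N : ℝ) ^ 2 * ∑ _i : Fin d, 7 * C * δ * M / (N : ℝ) ^ 2 * Φ x := by
          refine mul_le_mul_of_nonneg_left ?_ (by positivity)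
          exact (Finset.abs_sum_le_sum_abs _ _).trans (Finset.sum_le_sum fun i _ => h1 i)
      _ = _ := by
        simp only [Finset.sum_const, Finset.card_univ, Fintype.card_fin, nsmul_eq_mul]
        field_simp
  have hblock : ∀ x, |blockAvg N u x - Φ x * blockAvg N w x| ≤ 2 * C * δ * M * Φ x := fun x => by
    have e : blockAvg N u x - Φ x * blockAvg N w x =
        ((N : ℝ) ^ d)⁻¹ * ∑ z ∈ box (boxLabel N x), (Φ z - Φ x) * w z := by
      simp only [blockAvg, huw, Finset.mul_sum, ← Finset.sum_sub_distrib]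
      exact Finset.sum_congr rfl fun z _ => by ring
    have hx := hΦ x
    rw [e, abs_mul, abs_of_nonneg (by positivity)]
    calc _ ≤ ((N : ℝ) ^ d)⁻¹ * ∑ z ∈ box (boxLabel N x), 2 * δ * Φ x * (C * M) := by
          refine mul_le_mul_of_nonneg_left ?_ (by positivity)
          refine (Finset.abs_sum_le_sum_abs _ _).trans (Finset.sum_le_sum fun z hz => ?_)
          rw [abs_mul]
          exact mul_le_mul (hΦ3 x z hz) (hap z).1 (abs_nonneg _) (by positivity)
      _ = fill N x * (2 * C * δ * M * Φ x) := by
          simp only [fill, Finset.sum_const, nsmul_eq_mul]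
          ring
      _ ≤ _ := mul_le_of_le_one_left (by positivity) (fill_le_one hN0 x)
  have hMB : M ≤ B + M / 2 := by
    refine (pi_norm_le_iff_of_nonneg (by positivity)).2 fun x => ?_
    rw [Real.norm_eq_abs]
    have hx := hΦ x
    have e : Φ x * ham N μ a w x = ham N μ a u x + (lap N u x - Φ x * lap N w x) -
        a * (blockAvg N u x - Φ x * blockAvg N w x) := by
      simp only [ham, huw x]
      ring
    have h4 : Φ x * |ham N μ a w x| ≤ Φ x * (B + M / 2) := by
      rw [← abs_of_pos hx, ← abs_mul, abs_of_pos hx, e]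
      calc _ ≤ B * Φ x + 7 * d * C * δ * M * Φ x + a * (2 * C * δ * M * Φ x) := by
            refine (abs_sub _ _).trans (add_le_add ((abs_add_le _ _).trans
              (add_le_add (hu x) (hlap x))) ?_)
            rw [abs_mul, abs_of_nonneg ha]
            exact mul_le_mul_of_nonneg_left (hblock x) ha
        _ = Φ x * (B + (7 * d + 2 * a) * C * δ * M) := by ring
        _ ≤ Φ x * (B + 1 / 2 * M) := by gcongr
        _ = _ := by ring
    exact le_of_mul_le_mul_left h4 hx
  have hM2 : M ≤ 2 * B := by linarith
  have hx := hΦ x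
  rw [huw x, abs_mul, abs_of_pos hx]
  calc Φ x * |w x| ≤ Φ x * (C * (2 * B)) := by
        gcongr
        exact (hap x).1.trans (by gcongr)
    _ = _ := by ring

/-! ### Transfer to complex functions -/

/-- The operator has real coefficients, so it commutes with taking real parts. -/
theorem re_mul_hamiltonian (L k : ℕ) (a μ₀ : ℝ) (ζ : ℂ) (u : Cube d n → ℂ) (x : Cube d n) :
    (ζ * hamiltonian d n L k a μ₀ u x).re =
      ham (L ^ k) ((L : ℝ) ^ (2 * k) * μ₀) (aSeq a L k) (fun y => (ζ * u y).re) x := by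
  have hlap : (ζ * neumannLaplacian d n (spacing L k) u x).re =
      lap (L ^ k) (fun y => (ζ * u y).re) x := by
    have e : ζ * neumannLaplacian d n (spacing L k) u x = ∑ i : Fin d,
        ((((L : ℝ) ^ k) ^ 2 : ℝ) : ℂ) *
          ((ζ * u (nbr i true x) - ζ * u x) + (ζ * u (nbr i false x) - ζ * u x)) := by
      simp only [neumannLaplacian, LinearMap.coe_mk, AddHom.coe_mk, Finset.mul_sum]
      refine Finset.sum_congr rfl fun i _ => ?_
      rw [nbr_true, nbr_false, spacing]
      push_cast
      rw [inv_pow, div_inv_eq_mul]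
      ring
    rw [e, Complex.re_sum]
    simp only [Complex.re_ofReal_mul, Complex.add_re, Complex.sub_re, lap, Fintype.sum_bool,
      Finset.mul_sum, Nat.cast_pow]
  have havg : (ζ * (avgAdj d n (L ^ k) (avg d n (L ^ k) u)) x).re =
      blockAvg (L ^ k) (fun y => (ζ * u y).re) x := by
    have e : ζ * (avgAdj d n (L ^ k) (avg d n (L ^ k) u)) x =
        (((((L ^ k : ℕ) : ℝ) ^ d)⁻¹ : ℝ) : ℂ) * ∑ z ∈ box (boxLabel (L ^ k) x), ζ * u z := by
      simp only [avgAdj, avg, LinearMap.coe_mk, AddHom.coe_mk, ← Finset.mul_sum]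
      push_cast
      ring
    rw [e, Complex.re_ofReal_mul, Complex.re_sum, blockAvg]
  have e : ζ * hamiltonian d n L k a μ₀ u x =
      -(ζ * neumannLaplacian d n (spacing L k) u x) +
        (((L : ℝ) ^ (2 * k) * μ₀ : ℝ) : ℂ) * (ζ * u x) +
        ((aSeq a L k : ℝ) : ℂ) * (ζ * (avgAdj d n (L ^ k) (avg d n (L ^ k) u)) x) := by
    simp only [hamiltonian, LinearMap.add_apply, LinearMap.neg_apply, LinearMap.smul_apply,
      LinearMap.id_apply, LinearMap.comp_apply, Pi.add_apply, Pi.neg_apply, Pi.smul_apply,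
      smul_eq_mul]
    ring
  rw [e, Complex.add_re, Complex.add_re, Complex.neg_re, Complex.re_ofReal_mul,
    Complex.re_ofReal_mul, hlap, havg, ham]

theorem aSeq_mem_Icc {a : ℝ} (ha : 0 < a) {L k : ℕ} (hL : 1 < L) (hk : 1 ≤ k) :
    a / 2 ≤ aSeq a L k ∧ aSeq a L k ≤ a := by
  have hL' : (2 : ℝ) ≤ L := by exact_mod_cast hL
  have h1 : ((L : ℝ) ^ 2)⁻¹ ≤ 1 / 4 := by
    rw [inv_eq_one_div]
    exact one_div_le_one_div_of_le (by norm_num) (by nlinarith)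
  have h2 : (L : ℝ) ^ 2 ≤ (L : ℝ) ^ (2 * k) := pow_le_pow_right₀ (by linarith) (by omega)
  have h3 : ((L : ℝ) ^ (2 * k))⁻¹ ≤ ((L : ℝ) ^ 2)⁻¹ := by gcongr
  have h4 : 0 < ((L : ℝ) ^ (2 * k))⁻¹ := by positivity
  rw [aSeq]
  constructor
  · rw [le_div_iff₀ (by linarith)]
    nlinarith
  · rw [div_le_iff₀ (by linarith)]
    nlinarith

theorem dist_pt_le {L k : ℕ} (hL : 1 ≤ L) {B : ℝ} (hB : 0 ≤ B) (x z : Cube d n)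
    (h : ∀ i, |((z i : ℕ) : ℝ) - ((x i : ℕ) : ℝ)| ≤ B * (L : ℝ) ^ k) :
    dist (pt (spacing L k) x) (pt (spacing L k) z) ≤ d * B := by
  have hL' : (0 : ℝ) < (L : ℝ) ^ k := by
    have : (0 : ℝ) < L := by exact_mod_cast hL
    positivity
  have h1 : ∀ i, dist (pt (spacing L k) x i) (pt (spacing L k) z i) ≤ B := fun i => by
    have e : dist (pt (spacing L k) x i) (pt (spacing L k) z i) =
        |((z i : ℕ) : ℝ) - ((x i : ℕ) : ℝ)| / (L : ℝ) ^ k := by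
      simp only [pt, spacing]
      rw [dist_comm, Real.dist_eq, ← mul_sub, abs_mul, abs_of_pos (inv_pos.2 hL'), inv_mul_eq_div]
    rw [e, div_le_iff₀ hL']
    exact h i
  have hd2 : (d : ℝ) ≤ (d : ℝ) ^ 2 := by
    have : d ≤ d ^ 2 := Nat.le_self_pow two_ne_zero d
    exact_mod_cast this
  rw [EuclideanSpace.dist_eq]
  refine Real.sqrt_le_iff.2 ⟨by positivity, ?_⟩
  calc _ ≤ ∑ _i : Fin d, B ^ 2 := Finset.sum_le_sum fun i _ => by
        gcongr
        exact h1 i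
    _ = d * B ^ 2 := by simp
    _ ≤ (d : ℝ) ^ 2 * B ^ 2 := by gcongr
    _ = (d * B) ^ 2 := by ring

/-- The a priori bound implies the exponentially weighted bound for the complex operator. -/
theorem AprioriBound.norm_le_exp {L k q : ℕ} {a C δ μ₀ : ℝ} (hd : 1 ≤ d) (hL : 1 ≤ L)
    (ha : 0 ≤ aSeq a L k) (hC : 0 < C) (h : AprioriBound d (aSeq a L k) C) (hδ0 : 0 < δ)
    (hδ1 : δ ≤ 1) (hδ : (7 * d + 2 * aSeq a L k) * C * δ ≤ 1 / 2) (hN : 3 ≤ L ^ k) (hq : 1 ≤ q)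
    (hn : n = L ^ k * q + 1 ∨ n = L ^ k * q) (hμ : 0 ≤ μ₀) (u : Cube d n → ℂ) (x : Cube d n) :
    ‖u x‖ ≤ 4 * d * C * Real.exp (2 * δ) *
      Real.exp (-(δ / d) * Metric.infDist (pt (spacing L k) x)
        (pt (spacing L k) '' Function.support (hamiltonian d n L k a μ₀ u))) *
      ‖hamiltonian d n L k a μ₀ u‖ := by
  have hd' : (0 : ℝ) < d := by exact_mod_cast hd
  have hL' : (0 : ℝ) < (L : ℝ) ^ k := by
    have : (0 : ℝ) < L := by exact_mod_cast hL
    positivity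
  set f : Cube d n → ℂ := hamiltonian d n L k a μ₀ u with hf
  set D : ℝ := Metric.infDist (pt (spacing L k) x) (pt (spacing L k) '' Function.support f) with hD
  obtain ⟨Φ, hΦ0, hΦx, hΦexp, hΦ1, hΦ2, hΦ3⟩ := exists_weight hd (by omega : 1 ≤ L ^ k) hδ0 hδ1 x
  obtain ⟨ζ, hζ, hζu⟩ := RCLike.exists_norm_eq_mul_self (u x)
  have hsrc : ∀ y, |ham (L ^ k) ((L : ℝ) ^ (2 * k) * μ₀) (aSeq a L k) (fun y => (ζ * u y).re) y| ≤
      Real.exp (2 * δ) * Real.exp (-(δ / d) * D) * ‖f‖ * Φ y := fun y => by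
    rw [← re_mul_hamiltonian]
    refine (Complex.abs_re_le_norm _).trans ?_
    rw [norm_mul, hζ, one_mul]
    have hΦy := hΦ0 y
    by_cases hy : f y = 0
    · rw [← hf, hy, norm_zero]
      positivity
    -- some coordinate of `y - x` is at least `D / d`
    obtain ⟨i, -, hi⟩ := Finset.exists_max_image Finset.univ
      (fun i : Fin d => |((y i : ℕ) : ℝ) - ((x i : ℕ) : ℝ)|) ⟨⟨0, hd⟩, Finset.mem_univ _⟩
    have h1 : D ≤ d * (|((y i : ℕ) : ℝ) - ((x i : ℕ) : ℝ)| / (L : ℝ) ^ k) := by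
      refine (Metric.infDist_le_dist_of_mem (Set.mem_image_of_mem _ hy)).trans
        (dist_pt_le hL (by positivity) x y fun j => ?_)
      rw [div_mul_cancel₀ _ hL'.ne']
      exact hi j (Finset.mem_univ j)
    have h2 : δ / d * D ≤ δ / ((L ^ k : ℕ) : ℝ) * |((y i : ℕ) : ℝ) - ((x i : ℕ) : ℝ)| := by
      calc δ / d * D ≤ δ / d * (d * (|((y i : ℕ) : ℝ) - ((x i : ℕ) : ℝ)| / (L : ℝ) ^ k)) := by
            gcongr
        _ = _ := by
          rw [Nat.cast_pow]
          field_simp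
    have h3 : 1 ≤ Real.exp (2 * δ) * Real.exp (-(δ / d) * D) * Φ y := by
      have h4 := hΦexp y i
      have h5 : Real.exp (δ / d * D) ≤ Real.exp (2 * δ) * Φ y := (Real.exp_le_exp.2 h2).trans h4
      calc (1 : ℝ) = Real.exp (δ / d * D) * Real.exp (-(δ / d) * D) := by
            rw [← Real.exp_add, neg_mul, add_neg_cancel, Real.exp_zero]
        _ ≤ Real.exp (2 * δ) * Φ y * Real.exp (-(δ / d) * D) := by gcongr
        _ = _ := by ring
    calc ‖f y‖ ≤ ‖f‖ := norm_le_pi_norm f y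
      _ ≤ ‖f‖ * (Real.exp (2 * δ) * Real.exp (-(δ / d) * D) * Φ y) :=
          le_mul_of_one_le_right (norm_nonneg _) h3
      _ = _ := by ring
  have h6 := h.weighted ha hC hδ0 hδ hN hq hn (by positivity) Φ hΦ0 hΦ1 hΦ2 hΦ3
    (fun y => (ζ * u y).re) (by positivity) hsrc x
  have h7 : (ζ * u x).re = ‖u x‖ := by
    rw [← hζu]
    exact Complex.ofReal_re _
  rw [h7, abs_of_nonneg (norm_nonneg _), hΦx] at h6
  refine h6.trans (le_of_eq ?_)
  ring

end LatticeGreen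

end

theorem theoremA (d : ℕ) (hd : 1 ≤ d) (a : ℝ) (ha : 0 < a) :
    ∃ c c₁ : ℝ, 0 < c ∧ 0 < c₁ ∧
      ∀ (L k m n : ℕ) (μ₀ : ℝ), Odd L → 1 < L → 1 ≤ k → k ≤ m →
        (n = L ^ m + 1 ∨ n = L ^ m) → 0 ≤ μ₀ →
        IsUnit (LatticeGreen.hamiltonian d n L k a μ₀) ∧
        ∀ (f : LatticeGreen.Cube d n → ℂ) (x : LatticeGreen.Cube d n),
          ‖LatticeGreen.green d n L k a μ₀ f x‖ ≤
            c * (L : ℝ) ^ (2 * d) *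
              Real.exp (-c₁ * Metric.infDist (LatticeGreen.pt (LatticeGreen.spacing L k) x)
                (LatticeGreen.pt (LatticeGreen.spacing L k) '' Function.support f)) * ‖f‖ := by
  have hd' : (0 : ℝ) < d := by exact_mod_cast hd
  obtain ⟨s₀, hs₀, -, hsmall⟩ := LatticeGreen.small_coupling hd
  have hs : 0 < min s₀ (a / 2) := lt_min hs₀ (by positivity)
  obtain ⟨C₀, hC₀, hap₀⟩ := hsmall _ hs (min_le_left _ _)
  obtain ⟨C, hC, hap⟩ := hap₀.mono_coupling hs hC₀ ha
  obtain ⟨δ, hδ0, hδ1, hδ⟩ : ∃ δ : ℝ, 0 < δ ∧ δ ≤ 1 ∧ (7 * d + 2 * a) * C * δ ≤ 1 / 2 := by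
    refine ⟨min 1 (1 / (2 * ((7 * d + 2 * a) * C))), lt_min one_pos (by positivity),
      min_le_left _ _, ?_⟩
    calc _ ≤ (7 * d + 2 * a) * C * (1 / (2 * ((7 * d + 2 * a) * C))) := by
          gcongr
          exact min_le_right _ _
      _ = 1 / 2 := by field_simp
  refine ⟨4 * d * C * Real.exp (2 * δ), δ / d, by positivity, by positivity, ?_⟩
  intro L k m n μ₀ hodd hL hk hkm hn hμ
  have hL3 : 3 ≤ L := by
    obtain ⟨t, rfl⟩ := hodd
    omega
  have hN : 3 ≤ L ^ k := hL3.trans (Nat.le_self_pow (by omega) L)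
  have hLm : L ^ m = L ^ k * L ^ (m - k) := by rw [← pow_add, Nat.add_sub_cancel' hkm]
  rw [hLm] at hn
  obtain ⟨ha1, ha2⟩ := LatticeGreen.aSeq_mem_Icc ha hL hk
  have hbound := fun (u : LatticeGreen.Cube d n → ℂ) (x : LatticeGreen.Cube d n) =>
    (hap (LatticeGreen.aSeq a L k) ((min_le_right _ _).trans ha1) ha2).norm_le_exp hd hL.le (by linarith)
      hC hδ0 hδ1 (le_trans (by gcongr) hδ) hN (Nat.one_le_pow _ _ (by omega)) hn hμ u x
  have hunit : IsUnit (LatticeGreen.hamiltonian d n L k a μ₀) := by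
    rw [LinearMap.isUnit_iff_ker_eq_bot, LinearMap.ker_eq_bot']
    intro u hu
    funext x
    have h1 := hbound u x
    rw [hu, norm_zero, mul_zero] at h1
    exact norm_le_zero_iff.1 h1
  refine ⟨hunit, fun f x => ?_⟩
  have hinv : LatticeGreen.hamiltonian d n L k a μ₀ (LatticeGreen.green d n L k a μ₀ f) = f := by
    rw [LatticeGreen.green, ← Module.End.mul_apply, Ring.mul_inverse_cancel _ hunit,
      Module.End.one_apply]
  have h1 := hbound (LatticeGreen.green d n L k a μ₀ f) x
  rw [hinv] at h1
  have hL1 : (1 : ℝ) ≤ (L : ℝ) ^ (2 * d) := one_le_pow₀ (by exact_mod_cast hL.le)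
  refine h1.trans (mul_le_mul_of_nonneg_right (mul_le_mul_of_nonneg_right ?_ ?_) (norm_nonneg _))
  · exact le_mul_of_one_le_right (by positivity) hL1
  · exact (Real.exp_pos _).le
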